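/- Let $\{\zeta_t\}_{t\in\mathbb Z}$ be i.i.d. real random variables with $E\zeta_0=0$, $E\zeta_0^2=1$. For integers $s\le t$ let $\mathcal F_{[s,t]}=\sigma(\zeta_u: s\le u\le t)$, let $\mathcal F_{[s,t]}$ be trivial for $s>t$, and write $E_{[s,t]}\xi=E[\xi\mid\mathcal F_{[s,t]}]$. A *projective process* is a sequence $\{Y_t\}_{t\in\mathbb Z}$ of square integrable random variables, with $Y_t$ measurable with respect to $\sigma(\zeta_u:u\le t)$, such that $Y_t=EY_t+\sum_{s\le t}g_{s,t}\zeta_s$ (convergence in mean square), where $g_{s,t}$ is $\mathcal F_{[s+1,t]}$-measurable for $s<t$, $g_{t,t}$ is deterministic, and $\sum_{s\le t}Eg_{s,t}^2<\infty$ for every $t$. For $p\ge2$ let $\mu_p=E|\zeta_0|^p\in[1,\infty]$, and call a constant $C<\infty$ a *Rosenthal constant of order $p$* if, for every such innovation sequence with $\mu_p<\infty$, every projective process $\{Y_t\}$ with coefficients $g_{s,t}$ and every $t$ with $\sum_{s\le t}(E|g_{s,t}|^p)^{2/p}<\infty$, $$E|Y_t|^p\le C\Big(|EY_t|^p+\mu_p\Big(\sum_{s\le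 t}(E|g_{s,t}|^p)^{2/p}\Big)^{p/2}\Big).$$ Let $\mu\in\mathbb R$, let $\{\alpha_i\}_{i\ge0}$, $\{\beta_{i,j}\}_{i\ge0,j\ge1}$ be real arrays, and let $Q:\mathbb R\to\mathbb R$ be measurable with $|Q(x)|\le c_Q|x|$ for all $x$ and some constant $c_Q>0$. A *solution* of the projective stochastic equation $$X_t=\mu+\sum_{s\le t}\zeta_s\,Q_{s,t},\qquad Q_{s,t}:=Q\Big(\alpha_{t-s}+\sum_{s<u\le t}\beta_{t-u,u-s}\big(E_{[u,t]}X_t-E_{[u+1,t]}X_t\big)\Big),\qquad t\in\mathbb Z,$$ is a projective process $\{X_t\}$ with $\sum_{s\le t}EQ_{s,t}^2<\infty$ that satisfies the equation for every $t$ (the series converging in mean square). Put $$K_Q=\sum_{i=0}^\infty\alpha_i^2\sum_{k=0}^\infty c_Q^{2k+2}\sum_{j_1=1}^\infty\beta_{i,j_1}^2\cdots\sum_{j_k=1}^\infty\beta_{i+j_1+\dots+j_{k-1},j_k}^2,$$ $$K_{Q,p}=C_p^{2/p}\sum_{i=0}^\infty\alpha_i^2\sum_{k=0}^\infty\big(c_QC_p^{1/p}\mu_p^{1/p}\big)^{2k+2}\sum_{j_1=1}^\infty\beta_{i,j_1}^2\cdots\sum_{j_k=1}^\infty\beta_{i+j_1+\dots+j_{k-1},j_k}^2$$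 (with the convention $0\cdot\infty=0$). **Proposition.** Let $p\ge2$ be real. Rosenthal constants of order $p$ (depending on $p$ alone) exist. For every Rosenthal constant $C_p$ of order $p$: if $K_Q<\infty$ and $K_{Q,p}<\infty$, then the solution $\{X_t\}$ of the projective equation satisfies, for every $t\in\mathbb Z$, $$E|X_t|^p<\infty\qquad\text{and}\qquad \big(E|X_t-\mu|^p\big)^{2/p}\le K_{Q,p}.$$ In particular $(E|X_t|^p)^{2/p}\le K_{Q,p}$ when $\mu=0$. -/

import Mathlib

open MeasureTheory ProbabilityTheory Filter Topology
open scoped ENNReal NNReal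

universe u

noncomputable section

namespace ProjectiveEq

/-- The absolute moment `E |f| ^ p`, with values in `[0, ∞]`. -/
def absMoment {Ω : Type u} [MeasurableSpace Ω] (P : Measure Ω) (p : ℝ) (f : Ω → ℝ) : ℝ≥0∞ :=
  ∫⁻ ω, ‖f ω‖ₑ ^ p ∂P

/-- `ζ` is a sequence, indexed by `ℤ`, of i.i.d. random variables with mean `0` and variance `1`. -/
structure IsInnovation {Ω : Type u} [MeasurableSpace Ω] (P : Measure Ω) (ζ : ℤ → Ω → ℝ) :
    Prop where
  measurable : ∀ s, Measurable (ζ s)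
  indep : iIndepFun ζ P
  identDistrib : ∀ s, IdentDistrib (ζ s) (ζ 0) P P
  memLp : MemLp (ζ 0) 2 P
  mean_zero : ∫ ω, ζ 0 ω ∂P = 0
  var_one : ∫ ω, ζ 0 ω ^ 2 ∂P = 1

/-- The sigma-algebra generated by `ζ u`, `u ∈ S`; it is trivial for `S = ∅`. -/
@[reducible] def sigmaGen {Ω : Type u} (ζ : ℤ → Ω → ℝ) (S : Set ℤ) : MeasurableSpace Ω :=
  ⨆ v ∈ S, MeasurableSpace.comap (ζ v) (borel ℝ)

/-- The projection `E_{[s,t]} ξ`, the conditional expectation of `ξ` given `ζ u`, `s ≤ u ≤ t`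
(given the trivial sigma-algebra if `s > t`). -/
def proj {Ω : Type u} [MeasurableSpace Ω] (P : Measure Ω) (ζ : ℤ → Ω → ℝ) (s t : ℤ)
    (ξ : Ω → ℝ) : Ω → ℝ :=
  P[ξ | sigmaGen ζ (Set.Icc s t)]

/-- `Z = ∑_{s ≤ t} h s * ζ s`, with convergence of the series in mean square. -/
def IsMeanSquareSum {Ω : Type u} [MeasurableSpace Ω] (P : Measure Ω) (ζ : ℤ → Ω → ℝ) (t : ℤ)
    (h : ℤ → Ω → ℝ) (Z : Ω → ℝ) : Prop :=
  Tendsto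
    (fun n : ℕ => eLpNorm
      (fun ω => Z ω - ∑ k ∈ Finset.range n, h (t - (k : ℤ)) ω * ζ (t - (k : ℤ)) ω) 2 P)
    atTop (𝓝 0)

/-- `Y` is a projective process with coefficients `g s t`, `s ≤ t`. -/
structure IsProjectiveWith {Ω : Type u} [MeasurableSpace Ω] (P : Measure Ω) (ζ : ℤ → Ω → ℝ)
    (Y : ℤ → Ω → ℝ) (g : ℤ → ℤ → Ω → ℝ) : Prop where
  memLp : ∀ t, MemLp (Y t) 2 P
  adapted : ∀ t, AEStronglyMeasurable[sigmaGen ζ (Set.Iic t)] (Y t) P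
  coeff_measurable : ∀ s t, s < t →
    AEStronglyMeasurable[sigmaGen ζ (Set.Icc (s + 1) t)] (g s t) P
  coeff_diag : ∀ t, ∃ a : ℝ, g t t =ᵐ[P] fun _ => a
  coeff_sum : ∀ t, ∑' k : ℕ, absMoment P 2 (g (t - (k : ℤ)) t) < ∞
  expansion : ∀ t,
    IsMeanSquareSum P ζ t (fun s => g s t) (fun ω => Y t ω - ∫ ω', Y t ω' ∂P)

/-- `Y` is a projective process. -/
def IsProjective {Ω : Type u} [MeasurableSpace Ω] (P : Measure Ω) (ζ : ℤ → Ω → ℝ)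
    (Y : ℤ → Ω → ℝ) : Prop :=
  ∃ g : ℤ → ℤ → Ω → ℝ, IsProjectiveWith P ζ Y g

/-- `C` is an admissible constant of order `p` in the Rosenthal-type inequality
`E |Y_t| ^ p ≤ C (|E Y_t| ^ p + μ_p (∑_{s ≤ t} (E |g_{s,t}| ^ p) ^ (2 / p)) ^ (p / 2))`
for projective processes; it must serve all probability spaces, all innovation sequences and
all projective processes. -/
def IsRosenthalConstant (p : ℝ) (C : ℝ≥0) : Prop :=
  ∀ (Ω : Type u) [MeasurableSpace Ω] (P : Measure Ω) [IsProbabilityMeasure P]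
    (ζ : ℤ → Ω → ℝ), IsInnovation P ζ →
    ∀ (Y : ℤ → Ω → ℝ) (g : ℤ → ℤ → Ω → ℝ), IsProjectiveWith P ζ Y g →
      absMoment P p (ζ 0) < ∞ →
      ∀ t : ℤ, ∑' k : ℕ, absMoment P p (g (t - (k : ℤ)) t) ^ (2 / p) < ∞ →
        absMoment P p (Y t) ≤
          C * (‖∫ ω, Y t ω ∂P‖ₑ ^ p + absMoment P p (ζ 0) *
            (∑' k : ℕ, absMoment P p (g (t - (k : ℤ)) t) ^ (2 / p)) ^ (p / 2))

/-- The random coefficient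
`Q (α_{t-s} + ∑_{s < u ≤ t} β_{t-u,u-s} (E_{[u,t]} X_t - E_{[u+1,t]} X_t))`, for `s ≤ t`. -/
def kernelCoeff {Ω : Type u} [MeasurableSpace Ω] (P : Measure Ω) (ζ : ℤ → Ω → ℝ)
    (Q : ℝ → ℝ) (α : ℕ → ℝ) (β : ℕ → ℕ → ℝ) (X : ℤ → Ω → ℝ) (s t : ℤ) (ω : Ω) : ℝ :=
  Q (α (t - s).toNat + ∑ v ∈ Finset.Ioc s t,
    β (t - v).toNat (v - s).toNat * (proj P ζ v t (X t) ω - proj P ζ (v + 1) t (X t) ω))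

/-- `X` is a solution of the projective stochastic equation
`X_t = μ + ∑_{s ≤ t} ζ_s Q (α_{t-s} + ∑_{s<u≤t} β_{t-u,u-s} (E_{[u,t]} X_t - E_{[u+1,t]} X_t))`. -/
structure IsSolution {Ω : Type u} [MeasurableSpace Ω] (P : Measure Ω) (ζ : ℤ → Ω → ℝ)
    (m : ℝ) (Q : ℝ → ℝ) (α : ℕ → ℝ) (β : ℕ → ℕ → ℝ) (X : ℤ → Ω → ℝ) : Prop where
  projective : IsProjective P ζ X
  kernel_sum : ∀ t, ∑' k : ℕ, absMoment P 2 (kernelCoeff P ζ Q α β X (t - (k : ℤ)) t) < ∞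
  equation : ∀ t,
    IsMeanSquareSum P ζ t (fun s => kernelCoeff P ζ Q α β X s t) (fun ω => X t ω - m)

/-- `nestedSum β k i = ∑_{j₁ ≥ 1} β_{i,j₁}² ⋯ ∑_{j_k ≥ 1} β_{i+j₁+⋯+j_{k-1},j_k}²`, with
value `1` for `k = 0`. -/
def nestedSum (β : ℕ → ℕ → ℝ) : ℕ → ℕ → ℝ≥0∞
  | 0, _ => 1
  | k + 1, i => ∑' j : ℕ, ENNReal.ofReal (β i (j + 1) ^ 2) * nestedSum β k (i + (j + 1))

/-- `K_Q = ∑_i α_i² ∑_k c ^ (2k+2) ∑_{j₁} β_{i,j₁}² ⋯ ∑_{j_k} β_{i+j₁+⋯+j_{k-1},j_k}²`. -/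
def KQ (c : ℝ) (α : ℕ → ℝ) (β : ℕ → ℕ → ℝ) : ℝ≥0∞ :=
  ∑' i : ℕ, ENNReal.ofReal (α i ^ 2) *
    ∑' k : ℕ, ENNReal.ofReal c ^ (2 * k + 2) * nestedSum β k i

/-- `K_{Q,p} = C^{2/p} ∑_i α_i² ∑_k (c C^{1/p} M^{1/p}) ^ (2k+2) ∑_{j₁} β_{i,j₁}² ⋯`, where
`C` is the constant in the Rosenthal-type inequality and `M` the moment `E |ζ_0| ^ p`. -/
def KQp (p : ℝ) (C : ℝ≥0) (M : ℝ≥0∞) (c : ℝ) (α : ℕ → ℝ) (β : ℕ → ℕ → ℝ) : ℝ≥0∞ :=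
  (C : ℝ≥0∞) ^ (2 / p) * ∑' i : ℕ, ENNReal.ofReal (α i ^ 2) *
    ∑' k : ℕ, (ENNReal.ofReal c * (C : ℝ≥0∞) ^ (1 / p) * M ^ (1 / p)) ^ (2 * k + 2) *
      nestedSum β k i

end ProjectiveEq

end

/-!
Write `‖·‖` for the norm of `L^p` and `‖·‖²` for `absMoment P p · ^ (2 / p)`.

*Rosenthal constants.* In an expansion `∑ g_s ζ_s` at time `t`, the partial sums over
`t - n < s ≤ t` form a martingale as more and more of the past is revealed: `g_s` depends only on
innovations later than `s`, of which `ζ_s` is independent. For `p ≥ 2` the space `L^p` is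
two-smooth, so adding a martingale increment `d` to `x` increases `‖x‖²` by at most `K ‖d‖²`
(`absMoment_add_increment_le`). This follows from the second order Taylor bound for `|x + d|^p`
(`abs_add_rpow_le`), whose linear term has mean zero, and Hölder's inequality. Since
`‖g_s ζ_s‖² = ‖g_s‖² μ_p^{2/p}` by independence, summation and Fatou's lemma give the inequality
for infinite expansions (`exists_isRosenthalConstant`); no square function is needed.

*The moment bound.* Projecting the equation on a finite window of innovations truncates the sum
(`condExp_of_isMeanSquareSum`), so `E_{[v,t]} X_t - E_{[v+1,t]} X_t = ζ_v Q_{v,t}` and the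
coefficients solve the recursion
`Q_{s,t} = Q (α_{t-s} + ∑_{s < v ≤ t} β_{t-v,v-s} ζ_v Q_{v,t})`
(`IsSolution.kernelCoeff_recursion`). The argument of `Q` is a finite expansion, to which a
Rosenthal constant applies; with `|Q x| ≤ c |x|` this is a discrete Volterra inequality for
`a_i = ‖Q_{t-i,t}‖²` (`IsSolution.absMoment_kernelCoeff_le`). Iterating it along all paths produces
the nested sums (`tsum_le_of_recursion`), and a last use of the Rosenthal inequality, for `X - μ`,
yields `K_{Q,p}`. If `μ_p = ∞`, finiteness of `K_{Q,p}` forces `α = 0`, hence `X = μ`; here, and in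
dividing by the constant, one needs that a Rosenthal constant is not zero
(`IsRosenthalConstant.ne_zero`).
-/

namespace ProjectiveEq

/-! ### Elementary inequalities for powers -/

lemma rpow_sub_one_le_mul {y r : ℝ} (hy : 0 < y) (hr : 1 ≤ r) :
    y ^ r - 1 ≤ r * (y - 1) * y ^ (r - 1) := by
  -- Bernoulli's inequality at `1 / y`, multiplied by `y ^ r`
  have h := one_add_mul_self_le_rpow_one_add (s := y⁻¹ - 1)
    (by have := inv_pos.2 hy; linarith) hr
  rw [add_sub_cancel, Real.inv_rpow hy.le] at h
  have hyr : 0 < y ^ r := Real.rpow_pos_of_pos hy r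
  have h2 := mul_le_mul_of_nonneg_left h hyr.le
  rw [mul_inv_cancel₀ hyr.ne'] at h2
  have h3 : y ^ r = y ^ (r - 1) * y := by
    rw [← Real.rpow_add_one hy.ne', sub_add_cancel]
  have h4 : y ^ r * y⁻¹ = y ^ (r - 1) := by rw [h3]; field_simp
  nlinarith

lemma one_add_rpow_le {p v : ℝ} (hp : 2 ≤ p) (hv : -1 < v) (hv1 : v ≤ 1) :
    (1 + v) ^ p ≤ 1 + p * v + p ^ 2 * 2 ^ p * v ^ 2 := by
  have hy : 0 < 1 + v := by linarith
  have h1 := rpow_sub_one_le_mul hy (show 1 ≤ p by linarith)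
  rw [add_sub_cancel_left] at h1
  have h2p : (1 : ℝ) ≤ 2 ^ p := Real.one_le_rpow (by norm_num) (by linarith)
  suffices h : v * ((1 + v) ^ (p - 1) - 1) ≤ p * 2 ^ p * v ^ 2 by nlinarith
  rcases le_or_gt 0 v with h0 | h0
  · have h2 := rpow_sub_one_le_mul hy (show 1 ≤ p - 1 by linarith)
    rw [add_sub_cancel_left] at h2
    have h3 : (1 + v) ^ (p - 1 - 1) ≤ 2 ^ p :=
      (Real.rpow_le_rpow hy.le (by linarith) (by linarith)).trans
        (Real.rpow_le_rpow_of_exponent_le (by norm_num) (by linarith))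
    calc v * ((1 + v) ^ (p - 1) - 1) ≤ v * ((p - 1) * v * (1 + v) ^ (p - 1 - 1)) := by gcongr
      _ ≤ v * (p * v * 2 ^ p) := by
        have : 0 ≤ (1 + v) ^ (p - 1 - 1) := Real.rpow_nonneg hy.le _
        gcongr
        linarith
      _ = _ := by ring
  · have h2 := one_add_mul_self_le_rpow_one_add hv.le (show 1 ≤ p - 1 by linarith)
    calc v * ((1 + v) ^ (p - 1) - 1) ≤ v * ((p - 1) * v) :=
          mul_le_mul_of_nonpos_left (by linarith) h0.le
      _ = (p - 1) * v ^ 2 := by ring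
      _ ≤ p * 2 ^ p * v ^ 2 := by
        have : p - 1 ≤ p * 2 ^ p := by nlinarith
        gcongr

lemma abs_rpow_sub_two_mul_sq {p : ℝ} (hp : 2 ≤ p) (x : ℝ) : |x| ^ (p - 2) * x ^ 2 = |x| ^ p := by
  rw [← sq_abs x, ← Real.rpow_two, ← Real.rpow_add_of_nonneg (abs_nonneg x) (by linarith)
    (by norm_num), sub_add_cancel]

/-- Second order Taylor bound for `|x| ^ p`. The term of first order is linear in `d`, so that it
has mean zero when `d` is a martingale increment. -/
lemma abs_add_rpow_le {p : ℝ} (hp : 2 ≤ p) (x d : ℝ) :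
    |x + d| ^ p ≤ |x| ^ p + p * (|x| ^ (p - 2) * x * d) +
      p ^ 2 * 2 ^ p * (|x| ^ (p - 2) * d ^ 2 + |d| ^ p) := by
  have h2p : (1 : ℝ) ≤ 2 ^ p := Real.one_le_rpow (by norm_num) (by linarith)
  -- for `|d| < |x|` rescale to `x = 1`; otherwise all terms are dominated by `|d| ^ p`
  rcases lt_or_ge |d| |x| with h | h
  · have hx0 : x ≠ 0 := by
      rintro rfl
      simp at h
      linarith [abs_nonneg d]
    have hv : |d / x| < 1 := by
      rw [abs_div, div_lt_one (abs_pos.2 hx0)]; exact h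
    have hv' := abs_lt.1 hv
    have h1 := one_add_rpow_le hp hv'.1 hv'.2.le
    have h2 : |x + d| = |x| * (1 + d / x) := by
      rw [show x + d = x * (1 + d / x) by field_simp, abs_mul, abs_of_pos (a := 1 + d / x)]
      linarith
    have h3 : 0 ≤ |d| ^ p := by positivity
    rw [h2, Real.mul_rpow (abs_nonneg x) (by linarith)]
    calc |x| ^ p * (1 + d / x) ^ p
        ≤ |x| ^ p * (1 + p * (d / x) + p ^ 2 * 2 ^ p * (d / x) ^ 2) := by gcongr
      _ = |x| ^ p + p * (|x| ^ (p - 2) * x * d) + p ^ 2 * 2 ^ p * (|x| ^ (p - 2) * d ^ 2) := by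
        rw [← abs_rpow_sub_two_mul_sq hp x]; field_simp
      _ ≤ _ := by gcongr; linarith
  · have h1 : |x + d| ^ p ≤ 2 ^ p * |d| ^ p := by
      rw [← Real.mul_rpow (by norm_num) (abs_nonneg d)]
      refine Real.rpow_le_rpow (abs_nonneg _) ?_ (by linarith)
      linarith [abs_add_le x d]
    have h2 : |x| ^ (p - 2) * |x| * |d| ≤ |d| ^ p := by
      rw [← abs_rpow_sub_two_mul_sq hp d, ← sq_abs d, sq, ← mul_assoc]
      have : |x| ^ (p - 2) ≤ |d| ^ (p - 2) :=
        Real.rpow_le_rpow (abs_nonneg _) h (by linarith)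
      gcongr
    have h3 : -(|d| ^ p) ≤ |x| ^ (p - 2) * x * d := by
      refine (neg_le_neg h2).trans ?_
      have h4 := neg_abs_le (|x| ^ (p - 2) * x * d)
      rwa [abs_mul, abs_mul, abs_of_nonneg (Real.rpow_nonneg (abs_nonneg x) _)] at h4
    have h5 : 0 ≤ |d| ^ p := by positivity
    have h6 : 0 ≤ |x| ^ p := by positivity
    have h7 : 0 ≤ |x| ^ (p - 2) * d ^ 2 := by positivity
    have h8 : 2 ^ p + p ≤ p ^ 2 * 2 ^ p := by
      have h9 : p * 1 ≤ p * 2 ^ p := by gcongr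
      have h10 : 2 * 2 ^ p ≤ p * 2 ^ p := by gcongr
      have h11 : 2 * (p * 2 ^ p) ≤ p * (p * 2 ^ p) := by gcongr
      nlinarith
    nlinarith

/-- Absorbs the error terms of the Taylor bound into a sum of squared norms: here `a` and `b` stand
for squared `L^p` norms and `r = p / 2`. -/
lemma rpow_add_error_le {r K a b : ℝ} (hr : 1 ≤ r) (hK : 1 ≤ K) (ha : 0 ≤ a) (hb : 0 ≤ b) :
    a ^ r + K * (a ^ (r - 1) * b + b ^ r) ≤ (a + 2 * K * b) ^ r := by
  have hr0 : 0 < r := by linarith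
  -- the claim is the mean of superadditivity of `x ^ r` and of Bernoulli's inequality
  have h1 : a ^ r + 2 * K * b ^ r ≤ (a + 2 * K * b) ^ r := by
    refine le_trans ?_ (Real.add_rpow_le_rpow_add ha (by positivity) hr)
    rw [Real.mul_rpow (by linarith) hb]
    have : 2 * K ≤ (2 * K) ^ r := Real.self_le_rpow_of_one_le (by linarith) hr
    gcongr
  rcases ha.eq_or_lt with rfl | ha
  · have h2 : (0 : ℝ) ^ (r - 1) * b ≤ b ^ r := by
      rcases hr.eq_or_lt with rfl | hr
      · simp
      · rw [Real.zero_rpow (by linarith), zero_mul]; positivity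
    rw [Real.zero_rpow hr0.ne'] at h1 ⊢
    nlinarith
  · have h2 := one_add_mul_self_le_rpow_one_add (s := 2 * K * b / a)
      (by have : 0 ≤ 2 * K * b / a := by positivity
          linarith) hr
    have h3 : (a + 2 * K * b) ^ r = a ^ r * (1 + 2 * K * b / a) ^ r := by
      rw [← Real.mul_rpow ha.le (by positivity)]; congr 1; field_simp
    have h4 : a ^ r = a ^ (r - 1) * a := by rw [← Real.rpow_add_one ha.ne', sub_add_cancel]
    have h5 : a ^ r + r * (2 * K * b) * a ^ (r - 1) ≤ (a + 2 * K * b) ^ r := by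
      rw [h3]
      refine le_trans (le_of_eq ?_) (mul_le_mul_of_nonneg_left h2 (by positivity))
      rw [h4]; field_simp
    have h6 : 0 ≤ K * b * a ^ (r - 1) := by positivity
    nlinarith

/-! ### A discrete Volterra inequality -/

lemma tsum_sum_range_eq_tsum_tsum (f : ℕ → ℕ → ℝ≥0∞) :
    ∑' i, ∑ j ∈ Finset.range i, f j (i - j) = ∑' j, ∑' l, f j (l + 1) := by
  have h1 : ∀ i, ∑ j ∈ Finset.range i, f j (i - j) = ∑' j, if j < i then f j (i - j) else 0 := by
    intro i
    rw [tsum_eq_sum (s := Finset.range i)]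
    · exact Finset.sum_congr rfl fun j hj => by rw [if_pos (Finset.mem_range.1 hj)]
    · intro j hj
      rw [if_neg (by simpa using hj)]
  simp_rw [h1]
  rw [ENNReal.tsum_comm]
  refine tsum_congr fun j => ?_
  have hinj : Function.Injective fun l : ℕ => j + l + 1 := fun a b h => by simpa using h
  rw [← hinj.tsum_eq]
  · exact tsum_congr fun l => by rw [if_pos (by omega)]; congr 1; omega
  · intro i hi
    have : j < i := by by_contra h; simp [h] at hi
    exact ⟨i - j - 1, by simp only; omega⟩

/-- The `k`-th term of the Neumann series that solves the linear recursion
`b i = D * (a i + ∑_{j < i} β_{j,i-j}² * b j)`. -/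
noncomputable def neumannTerm (D : ℝ≥0∞) (a : ℕ → ℝ≥0∞) (β : ℕ → ℕ → ℝ) : ℕ → ℕ → ℝ≥0∞
  | 0, i => D * a i
  | k + 1, i => D * ∑ j ∈ Finset.range i,
      ENNReal.ofReal (β j (i - j) ^ 2) * neumannTerm D a β k j

/-- Moving one step of a path from the Neumann term to the nested sum is a change of the order of
summation. -/
lemma tsum_neumannTerm_mul_nestedSum (D : ℝ≥0∞) (a : ℕ → ℝ≥0∞) (β : ℕ → ℕ → ℝ) (k : ℕ) :
    ∀ l, ∑' i, neumannTerm D a β k i * (D ^ l * nestedSum β l i) =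
      ∑' i, a i * (D ^ (k + l + 1) * nestedSum β (k + l) i) := by
  induction k with
  | zero =>
    intro l
    refine tsum_congr fun i => ?_
    rw [neumannTerm, zero_add, pow_succ]; ring
  | succ k ih =>
    intro l
    rw [show k + 1 + l = k + (l + 1) by ring, ← ih (l + 1)]
    set f : ℕ → ℕ → ℝ≥0∞ := fun j m => neumannTerm D a β k j * D ^ (l + 1) *
      (ENNReal.ofReal (β j m ^ 2) * nestedSum β l (j + m)) with hf
    have h1 : ∀ i, neumannTerm D a β (k + 1) i * (D ^ l * nestedSum β l i) =
        ∑ j ∈ Finset.range i, f j (i - j) := by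
      intro i
      rw [neumannTerm, Finset.mul_sum, Finset.sum_mul]
      refine Finset.sum_congr rfl fun j hj => ?_
      have : j + (i - j) = i := by have := Finset.mem_range.1 hj; omega
      simp only [hf, this]
      ring
    rw [tsum_congr h1, tsum_sum_range_eq_tsum_tsum]
    refine tsum_congr fun j => ?_
    rw [nestedSum, ENNReal.tsum_mul_left, mul_assoc]

lemma le_tsum_neumannTerm {D : ℝ≥0∞} {a b : ℕ → ℝ≥0∞} {β : ℕ → ℕ → ℝ}
    (h : ∀ i, b i ≤ D * (a i + ∑ j ∈ Finset.range i, ENNReal.ofReal (β j (i - j) ^ 2) * b j))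
    (i : ℕ) : b i ≤ ∑' k, neumannTerm D a β k i := by
  induction i using Nat.strong_induction_on with
  | _ i ih =>
    rw [tsum_eq_zero_add' ENNReal.summable]
    refine (h i).trans ?_
    simp only [neumannTerm]
    rw [mul_add, ENNReal.tsum_mul_left, Summable.tsum_finsetSum fun _ _ => ENNReal.summable]
    gcongr with j hj
    rw [ENNReal.tsum_mul_left]
    gcongr
    exact ih j (Finset.mem_range.1 hj)

/-- Iterating the recursion along all paths `i, i + j₁, i + j₁ + j₂, …` bounds the sum of a
subsolution by the nested sums. -/
lemma tsum_le_of_recursion {D : ℝ≥0∞} {a b : ℕ → ℝ≥0∞} {β : ℕ → ℕ → ℝ}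
    (h : ∀ i, b i ≤ D * (a i + ∑ j ∈ Finset.range i, ENNReal.ofReal (β j (i - j) ^ 2) * b j)) :
    ∑' i, b i ≤ ∑' i, a i * ∑' k, D ^ (k + 1) * nestedSum β k i := by
  refine (ENNReal.tsum_le_tsum (le_tsum_neumannTerm h)).trans_eq ?_
  rw [ENNReal.tsum_comm]
  simp_rw [← ENNReal.tsum_mul_left]
  rw [ENNReal.tsum_comm (f := fun i k => a i * (D ^ (k + 1) * nestedSum β k i))]
  refine tsum_congr fun k => ?_
  have := tsum_neumannTerm_mul_nestedSum D a β k 0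
  simpa [nestedSum] using this

/-! ### Absolute moments -/

section Moments

variable {Ω : Type u} [m0 : MeasurableSpace Ω] {P : Measure Ω}

lemma absMoment_congr {p : ℝ} {f g : Ω → ℝ} (h : f =ᵐ[P] g) : absMoment P p f = absMoment P p g :=
  lintegral_congr_ae (h.mono fun ω hω => by simp only [hω])

lemma absMoment_zero {p : ℝ} (hp : 0 < p) : absMoment P p (fun _ => (0 : ℝ)) = 0 := by
  simp [absMoment, hp]

lemma absMoment_const [IsProbabilityMeasure P] (p : ℝ) (a : ℝ) :
    absMoment P p (fun _ => a) = ‖a‖ₑ ^ p := by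
  simp [absMoment]

lemma absMoment_const_mul {p : ℝ} (hp : 0 ≤ p) (a : ℝ) (f : Ω → ℝ) :
    absMoment P p (fun ω => a * f ω) = ‖a‖ₑ ^ p * absMoment P p f := by
  simp only [absMoment, enorm_mul, ENNReal.mul_rpow_of_nonneg _ _ hp]
  exact lintegral_const_mul' _ _ (ENNReal.rpow_ne_top_of_nonneg hp enorm_ne_top)

lemma absMoment_two_eq_eLpNorm_sq (f : Ω → ℝ) : absMoment P 2 f = eLpNorm f 2 P ^ 2 := by
  rw [eLpNorm_eq_lintegral_rpow_enorm_toReal (by norm_num) (by norm_num), ← ENNReal.rpow_two,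
    ← ENNReal.rpow_mul]
  simp [absMoment]

lemma memLp_two_of_absMoment_lt_top {f : Ω → ℝ} (hf : AEStronglyMeasurable f P)
    (h : absMoment P 2 f < ∞) : MemLp f 2 P := by
  refine ⟨hf, ?_⟩
  rw [absMoment_two_eq_eLpNorm_sq] at h
  exact (ENNReal.pow_lt_top_iff.1 h).resolve_right (by norm_num)

/-- `E|f + g|^p ≤ 2^{p-1} (E|f|^p + E|g|^p)`. -/
lemma absMoment_add_le {p : ℝ} (hp : 1 ≤ p) {f g : Ω → ℝ} (hf : AEStronglyMeasurable f P) :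
    absMoment P p (fun ω => f ω + g ω) ≤
      2 ^ (p - 1) * (absMoment P p f + absMoment P p g) := by
  have hf' : AEMeasurable (fun ω => ‖f ω‖ₑ ^ p) P := hf.enorm.pow_const p
  rw [absMoment, absMoment, absMoment, ← lintegral_add_left' hf', ← lintegral_const_mul']
  · refine lintegral_mono fun ω => ?_
    refine (ENNReal.rpow_le_rpow (enorm_add_le _ _) (by linarith)).trans ?_
    rw [mul_add]
    have := ENNReal.rpow_add_le_mul_rpow_add_rpow ‖f ω‖ₑ ‖g ω‖ₑ hp
    rwa [mul_add] at this
  · exact ENNReal.rpow_ne_top_of_nonneg (by linarith) (by norm_num)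

lemma absMoment_mul_of_indepFun {p : ℝ} (hp : 0 ≤ p) {G Z : Ω → ℝ}
    (hG : AEStronglyMeasurable G P) (hZ : Measurable Z) (h : IndepFun G Z P) :
    absMoment P p (fun ω => G ω * Z ω) = absMoment P p G * absMoment P p Z := by
  simp only [absMoment, enorm_mul, ENNReal.mul_rpow_of_nonneg _ _ hp]
  have hm : Measurable fun x : ℝ => ‖x‖ₑ ^ p := measurable_enorm.pow_const p
  exact lintegral_mul_eq_lintegral_mul_lintegral_of_indepFun''
    (hG.enorm.pow_const p) (hm.comp hZ).aemeasurable (h.comp hm hm)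

lemma enorm_abs_rpow {p : ℝ} (hp : 0 ≤ p) (x : ℝ) : ‖|x| ^ p‖ₑ = ‖x‖ₑ ^ p := by
  rw [Real.enorm_rpow_of_nonneg (abs_nonneg x) hp, Real.enorm_abs]

lemma integrable_abs_rpow {p : ℝ} (hp : 0 ≤ p) {f : Ω → ℝ} (hf : AEStronglyMeasurable f P)
    (h : absMoment P p f < ∞) : Integrable (fun ω => |f ω| ^ p) P := by
  refine ⟨(hf.norm.aemeasurable.pow_const p).aestronglyMeasurable, ?_⟩
  simpa only [HasFiniteIntegral, enorm_abs_rpow hp, absMoment] using h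

lemma absMoment_eq_ofReal_integral {p : ℝ} (hp : 0 ≤ p) {f : Ω → ℝ}
    (hf : AEStronglyMeasurable f P) (h : absMoment P p f < ∞) :
    absMoment P p f = ENNReal.ofReal (∫ ω, |f ω| ^ p ∂P) := by
  rw [ofReal_integral_eq_lintegral_ofReal (integrable_abs_rpow hp hf h)
    (Eventually.of_forall fun ω => by positivity)]
  refine lintegral_congr fun ω => ?_
  rw [← enorm_abs_rpow hp, Real.enorm_of_nonneg (by positivity)]

lemma indepFun_of_aestronglyMeasurable {Ω : Type u} {m1 : MeasurableSpace Ω}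
    [m0 : MeasurableSpace Ω] {P : Measure Ω} {F Z : Ω → ℝ}
    (hF : AEStronglyMeasurable[m1] F P) (hind : Indep m1 (MeasurableSpace.comap Z (borel ℝ)) P) :
    IndepFun F Z P := by
  have h1 : IndepFun (hF.mk F) Z P := by
    rw [IndepFun_iff_Indep]
    exact indep_of_indep_of_le_left hind hF.stronglyMeasurable_mk.measurable.comap_le
  exact h1.congr hF.ae_eq_mk.symm ae_eq_rfl

end Moments

/-! ### Two-smoothness of `L^p` along martingale increments -/

section Smoothness

variable {Ω : Type u} [m0 : MeasurableSpace Ω] {P : Measure Ω}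

lemma abs_rpow_sub_two_mul_sq_le {p : ℝ} (hp : 2 ≤ p) (x d : ℝ) :
    |x| ^ (p - 2) * d ^ 2 ≤ |x| ^ p + |d| ^ p := by
  rcases le_total |x| |d| with h | h
  · have : |x| ^ (p - 2) ≤ |d| ^ (p - 2) := Real.rpow_le_rpow (abs_nonneg _) h (by linarith)
    have h2 : |x| ^ (p - 2) * d ^ 2 ≤ |d| ^ (p - 2) * d ^ 2 := by gcongr
    rw [abs_rpow_sub_two_mul_sq hp] at h2
    have : 0 ≤ |x| ^ p := by positivity
    linarith
  · have h2 : |x| ^ (p - 2) * d ^ 2 ≤ |x| ^ (p - 2) * x ^ 2 := by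
      have := sq_le_sq.2 h
      gcongr
    rw [abs_rpow_sub_two_mul_sq hp] at h2
    have : 0 ≤ |d| ^ p := by positivity
    linarith

lemma abs_rpow_sub_two_mul_mul_le {p : ℝ} (hp : 2 ≤ p) (x d : ℝ) :
    |(|x| ^ (p - 2) * x * d)| ≤ |x| ^ p + |d| ^ p := by
  have h1 := abs_rpow_sub_two_mul_sq_le hp x d
  have h2 := abs_rpow_sub_two_mul_sq hp x
  have h3 : 0 ≤ |d| ^ p := by positivity
  have h4 : 0 ≤ |x| ^ (p - 2) := by positivity
  rw [abs_mul, abs_mul, abs_of_nonneg h4, mul_assoc]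
  have h5 : |x| * |d| ≤ (x ^ 2 + d ^ 2) / 2 := by
    rw [← sq_abs x, ← sq_abs d]; nlinarith [sq_nonneg (|x| - |d|)]
  nlinarith [mul_le_mul_of_nonneg_left h5 h4]

lemma integral_abs_rpow_sub_two_mul_sq_le {p : ℝ} (hp : 2 ≤ p) {X d : Ω → ℝ}
    (hX : AEStronglyMeasurable X P) (hd : AEStronglyMeasurable d P)
    (hXp : absMoment P p X < ∞) (hdp : absMoment P p d < ∞) :
    ∫ ω, |X ω| ^ (p - 2) * d ω ^ 2 ∂P ≤
      (∫ ω, |X ω| ^ p ∂P) ^ (1 - 2 / p) * (∫ ω, |d ω| ^ p ∂P) ^ (2 / p) := by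
  have hp0 : 0 < p := by linarith
  have h2p : 2 / p ≤ 1 := by rw [div_le_one hp0]; exact hp
  have hA : 0 ≤ ∫ ω, |X ω| ^ p ∂P := integral_nonneg fun ω => by positivity
  have hB : 0 ≤ ∫ ω, |d ω| ^ p ∂P := integral_nonneg fun ω => by positivity
  have key := ENNReal.lintegral_mul_norm_pow_le (μ := P) (f := fun ω => ‖X ω‖ₑ ^ p)
    (g := fun ω => ‖d ω‖ₑ ^ p) (hX.enorm.pow_const p) (hd.enorm.pow_const p)
    (p := 1 - 2 / p) (q := 2 / p) (by linarith) (by positivity) (by ring)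
  change _ ≤ absMoment P p X ^ (1 - 2 / p) * absMoment P p d ^ (2 / p) at key
  rw [absMoment_eq_ofReal_integral hp0.le hX hXp, absMoment_eq_ofReal_integral hp0.le hd hdp,
    ENNReal.ofReal_rpow_of_nonneg hA (by linarith),
    ENNReal.ofReal_rpow_of_nonneg hB (by positivity), ← ENNReal.ofReal_mul (by positivity)] at key
  have hm : AEStronglyMeasurable (fun ω => |X ω| ^ (p - 2) * d ω ^ 2) P :=
    ((hX.norm.aemeasurable.pow_const (p - 2)).mul
      (hd.aemeasurable.pow_const 2)).aestronglyMeasurable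
  rw [integral_eq_lintegral_of_nonneg_ae (Eventually.of_forall fun ω => by positivity) hm]
  refine ENNReal.toReal_le_of_le_ofReal (by positivity) (le_trans (le_of_eq ?_) key)
  refine lintegral_congr fun ω => ?_
  rw [← ENNReal.rpow_mul, ← ENNReal.rpow_mul, show p * (1 - 2 / p) = p - 2 by field_simp,
    show p * (2 / p) = 2 by field_simp, ← enorm_abs_rpow (by linarith),
    ← enorm_abs_rpow (by norm_num), ← enorm_mul, Real.enorm_of_nonneg (by positivity),
    Real.rpow_two, sq_abs]

/-- Adding an increment `G * Z`, with `Z` centred and independent of the past `m1`, increases the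
squared `L^p` norm by at most a constant multiple of the squared `L^p` norm of the increment. -/
lemma absMoment_add_increment_le {Ω : Type u} {m1 : MeasurableSpace Ω} [m0 : MeasurableSpace Ω]
    {P : Measure Ω} [IsProbabilityMeasure P] {p : ℝ} (hp : 2 ≤ p) (hm1 : m1 ≤ m0) {X G Z : Ω → ℝ}
    (hX : AEStronglyMeasurable[m1] X P) (hG : AEStronglyMeasurable[m1] G P) (hZ : Measurable Z)
    (hind : Indep m1 (MeasurableSpace.comap Z (borel ℝ)) P) (hZ0 : ∫ ω, Z ω ∂P = 0)
    (hXp : absMoment P p X < ∞) (hdp : absMoment P p (fun ω => G ω * Z ω) < ∞) :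
    absMoment P p (fun ω => X ω + G ω * Z ω) ^ (2 / p) ≤
      absMoment P p X ^ (2 / p) +
        ENNReal.ofReal (2 * (p ^ 2 * 2 ^ p)) * absMoment P p (fun ω => G ω * Z ω) ^ (2 / p) := by
  have hp0 : 0 < p := by linarith
  set K : ℝ := p ^ 2 * 2 ^ p with hK
  have hK1 : 1 ≤ K := by
    have : (1 : ℝ) ≤ 2 ^ p := Real.one_le_rpow (by norm_num) hp0.le
    nlinarith
  have hX0 : AEStronglyMeasurable X P := hX.mono hm1
  have hG0 : AEStronglyMeasurable G P := hG.mono hm1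
  set d : Ω → ℝ := fun ω => G ω * Z ω with hd
  have hd0 : AEStronglyMeasurable d P := hG0.mul hZ.aestronglyMeasurable
  have hA : 0 ≤ ∫ ω, |X ω| ^ p ∂P := integral_nonneg fun ω => by positivity
  have hB : 0 ≤ ∫ ω, |d ω| ^ p ∂P := integral_nonneg fun ω => by positivity
  have iX := integrable_abs_rpow hp0.le hX0 hXp
  have id' := integrable_abs_rpow hp0.le hd0 hdp
  have hXm : AEStronglyMeasurable (fun ω => |X ω| ^ (p - 2)) P :=
    (hX0.norm.aemeasurable.pow_const (p - 2)).aestronglyMeasurable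
  have iXd : Integrable (fun ω => |X ω| ^ (p - 2) * X ω * d ω) P :=
    (iX.add id').mono' ((hXm.mul hX0).mul hd0)
      (Eventually.of_forall fun ω => abs_rpow_sub_two_mul_mul_le hp _ _)
  have iX2 : Integrable (fun ω => |X ω| ^ (p - 2) * d ω ^ 2) P := by
    refine (iX.add id').mono' (hXm.mul (hd0.pow 2)) (Eventually.of_forall fun ω => ?_)
    rw [Real.norm_of_nonneg (by positivity)]
    exact abs_rpow_sub_two_mul_sq_le hp _ _
  have hsp : absMoment P p (fun ω => X ω + d ω) < ∞ :=
    (absMoment_add_le (by linarith) hX0).trans_lt (ENNReal.mul_lt_top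
      (ENNReal.rpow_lt_top_of_nonneg (by linarith) (by norm_num)) (ENNReal.add_lt_top.2 ⟨hXp, hdp⟩))
  have is := integrable_abs_rpow hp0.le (hX0.add hd0) hsp
  have hcross : ∫ ω, |X ω| ^ (p - 2) * X ω * d ω ∂P = 0 := by
    have hc : Continuous fun x : ℝ => |x| ^ (p - 2) * x :=
      (continuous_abs.rpow_const fun _ => Or.inr (by linarith)).mul continuous_id
    have hF : AEStronglyMeasurable[m1] (fun ω => |X ω| ^ (p - 2) * X ω * G ω) P :=
      (hc.comp_aestronglyMeasurable hX).mul hG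
    have hi := indepFun_of_aestronglyMeasurable hF hind
    have := hi.integral_fun_mul_eq_mul_integral (hF.mono hm1) hZ.aestronglyMeasurable
    rw [hZ0, mul_zero] at this
    simpa only [hd, mul_assoc] using this
  have hle : ∫ ω, |X ω + d ω| ^ p ∂P ≤ ∫ ω, |X ω| ^ p ∂P +
      K * (∫ ω, |X ω| ^ (p - 2) * d ω ^ 2 ∂P + ∫ ω, |d ω| ^ p ∂P) := by
    have h1 : ∫ ω, |X ω + d ω| ^ p ∂P ≤ ∫ ω, (|X ω| ^ p + p * (|X ω| ^ (p - 2) * X ω * d ω) +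
        K * (|X ω| ^ (p - 2) * d ω ^ 2 + |d ω| ^ p)) ∂P :=
      integral_mono is ((iX.add (iXd.const_mul p)).add ((iX2.add id').const_mul K))
        fun ω => abs_add_rpow_le hp _ _
    have hi1 : Integrable (fun ω => |X ω| ^ p + p * (|X ω| ^ (p - 2) * X ω * d ω)) P :=
      iX.add (iXd.const_mul p)
    have hi2 : Integrable (fun ω => K * (|X ω| ^ (p - 2) * d ω ^ 2 + |d ω| ^ p)) P :=
      (iX2.add id').const_mul K
    rw [integral_add hi1 hi2, integral_add iX (iXd.const_mul p), integral_const_mul, hcross,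
      integral_const_mul, integral_add iX2 id', mul_zero, add_zero] at h1
    exact h1
  have hH := integral_abs_rpow_sub_two_mul_sq_le hp hX0 hd0 hXp hdp
  have hr := rpow_add_error_le (r := p / 2) (K := K) (by linarith) hK1
    (Real.rpow_nonneg hA (2 / p)) (Real.rpow_nonneg hB (2 / p))
  rw [← Real.rpow_mul hA, ← Real.rpow_mul hA, ← Real.rpow_mul hB,
    show 2 / p * (p / 2) = 1 by field_simp, show 2 / p * (p / 2 - 1) = 1 - 2 / p by field_simp,
    Real.rpow_one, Real.rpow_one] at hr
  have hfin : ∫ ω, |X ω + d ω| ^ p ∂P ≤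
      ((∫ ω, |X ω| ^ p ∂P) ^ (2 / p) + 2 * K * (∫ ω, |d ω| ^ p ∂P) ^ (2 / p)) ^ (p / 2) := by
    refine hle.trans (le_trans ?_ hr)
    gcongr
  have hT : 0 ≤ ∫ ω, |X ω + d ω| ^ p ∂P := integral_nonneg fun ω => by positivity
  have hfin2 := Real.rpow_le_rpow hT hfin (show 0 ≤ 2 / p by positivity)
  rw [← Real.rpow_mul (by positivity), show p / 2 * (2 / p) = 1 by field_simp,
    Real.rpow_one] at hfin2
  rw [absMoment_eq_ofReal_integral (f := fun ω => X ω + d ω) hp0.le (hX0.add hd0) hsp,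
    absMoment_eq_ofReal_integral hp0.le hX0 hXp, absMoment_eq_ofReal_integral hp0.le hd0 hdp,
    ENNReal.ofReal_rpow_of_nonneg hA (by positivity),
    ENNReal.ofReal_rpow_of_nonneg hB (by positivity),
    ENNReal.ofReal_rpow_of_nonneg (integral_nonneg fun ω => by positivity) (by positivity),
    ← ENNReal.ofReal_mul (by positivity), ← ENNReal.ofReal_add (by positivity) (by positivity)]
  exact ENNReal.ofReal_le_ofReal hfin2

end Smoothness

/-! ### Innovations and the sigma-algebras they generate -/

section Innovation

lemma sigmaGen_mono {Ω : Type u} {ζ : ℤ → Ω → ℝ} {S T : Set ℤ} (h : S ⊆ T) :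
    sigmaGen ζ S ≤ sigmaGen ζ T :=
  biSup_mono h

lemma stronglyMeasurable_sigmaGen {Ω : Type u} {ζ : ℤ → Ω → ℝ} {S : Set ℤ} {s : ℤ} (h : s ∈ S) :
    StronglyMeasurable[sigmaGen ζ S] (ζ s) := by
  have : MeasurableSpace.comap (ζ s) (borel ℝ) ≤ sigmaGen ζ S :=
    le_iSup₂ (f := fun v (_ : v ∈ S) => MeasurableSpace.comap (ζ v) (borel ℝ)) s h
  exact (Measurable.of_comap_le this).stronglyMeasurable

variable {Ω : Type u} [m0 : MeasurableSpace Ω] {P : Measure Ω} {ζ : ℤ → Ω → ℝ}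

lemma IsInnovation.memLp_two (h : IsInnovation P ζ) (s : ℤ) : MemLp (ζ s) 2 P :=
  (h.identDistrib s).memLp_iff.2 h.memLp

lemma IsInnovation.integral_eq_zero (h : IsInnovation P ζ) (s : ℤ) : ∫ ω, ζ s ω ∂P = 0 :=
  (h.identDistrib s).integral_eq.trans h.mean_zero

lemma IsInnovation.absMoment_eq (h : IsInnovation P ζ) (p : ℝ) (s : ℤ) :
    absMoment P p (ζ s) = absMoment P p (ζ 0) :=
  ((h.identDistrib s).comp (u := fun x : ℝ => ‖x‖ₑ ^ p)
    (measurable_enorm.pow_const p)).lintegral_eq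

lemma IsInnovation.not_ae_eq_zero (h : IsInnovation P ζ) : ¬ ζ 0 =ᵐ[P] 0 := by
  intro h0
  have h1 : ∫ ω, ζ 0 ω ^ 2 ∂P = ∫ ω, (0 : ℝ) ∂P :=
    integral_congr_ae (h0.mono fun ω hω => by simp [hω])
  rw [h.var_one, integral_zero] at h1
  exact one_ne_zero h1

lemma IsInnovation.absMoment_ne_zero (h : IsInnovation P ζ) {p : ℝ} (hp : 0 < p) :
    absMoment P p (ζ 0) ≠ 0 := by
  intro h0
  rw [absMoment, lintegral_eq_zero_iff ((h.measurable 0).enorm.pow_const p)] at h0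
  exact h.not_ae_eq_zero (h0.mono fun ω hω => by simpa [hp, hp.not_gt] using hω)

lemma sigmaGen_le (h : ∀ s, Measurable (ζ s)) (S : Set ℤ) : sigmaGen ζ S ≤ m0 :=
  iSup₂_le fun v _ => (h v).comap_le

lemma IsInnovation.indep_sigmaGen (h : IsInnovation P ζ) {S : Set ℤ} {s : ℤ} (hs : s ∉ S) :
    Indep (sigmaGen ζ S) (MeasurableSpace.comap (ζ s) (borel ℝ)) P := by
  have h1 := indep_iSup_of_disjoint (m := fun v => MeasurableSpace.comap (ζ v) (borel ℝ))
    (fun v => (h.measurable v).comap_le) h.indep (S := S) (T := {s})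
    (Set.disjoint_singleton_right.2 hs)
  simpa using h1

/-- A coefficient `g` that may multiply `ζ s` in an expansion at time `t` is independent of
`ζ s`. -/
lemma IsInnovation.indepFun_coeff (h : IsInnovation P ζ) {s t : ℤ} {g : Ω → ℝ}
    (hg : AEStronglyMeasurable[sigmaGen ζ (Set.Icc (s + 1) t)] g P) : IndepFun g (ζ s) P :=
  indepFun_of_aestronglyMeasurable hg (h.indep_sigmaGen (by simp))

lemma IsInnovation.absMoment_coeff_mul (h : IsInnovation P ζ) {p : ℝ} (hp : 0 ≤ p) {s t : ℤ}
    {g : Ω → ℝ} (hg : AEStronglyMeasurable[sigmaGen ζ (Set.Icc (s + 1) t)] g P) :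
    absMoment P p (fun ω => g ω * ζ s ω) = absMoment P p g * absMoment P p (ζ 0) := by
  rw [absMoment_mul_of_indepFun hp (hg.mono (sigmaGen_le h.measurable _)) (h.measurable s)
    (h.indepFun_coeff hg), h.absMoment_eq]

lemma IsProjectiveWith.coeff_aestronglyMeasurable {Y : ℤ → Ω → ℝ} {g : ℤ → ℤ → Ω → ℝ}
    (h : IsProjectiveWith P ζ Y g) {s t : ℤ} (hst : s ≤ t) :
    AEStronglyMeasurable[sigmaGen ζ (Set.Icc (s + 1) t)] (g s t) P := by
  rcases hst.lt_or_eq with hst | rfl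
  · exact h.coeff_measurable s t hst
  · obtain ⟨a, ha⟩ := h.coeff_diag s
    exact (aestronglyMeasurable_const (b := a)).congr ha.symm

end Innovation

/-! ### Existence of Rosenthal constants -/

section Rosenthal

variable {Ω : Type u} [m0 : MeasurableSpace Ω] {P : Measure Ω} {ζ : ℤ → Ω → ℝ}

/-- The partial sum `∑_{t-n < s ≤ t} g s * ζ s` of an expansion at time `t`. -/
noncomputable def partialSum (ζ : ℤ → Ω → ℝ) (t : ℤ) (g : ℤ → Ω → ℝ) (n : ℕ) (ω : Ω) : ℝ :=
  ∑ k ∈ Finset.range n, g (t - (k : ℤ)) ω * ζ (t - (k : ℤ)) ω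

lemma partialSum_zero {Ω : Type u} (ζ : ℤ → Ω → ℝ) (t : ℤ) (g : ℤ → Ω → ℝ) :
    partialSum ζ t g 0 = fun _ => 0 := by
  funext ω
  simp [partialSum]

lemma partialSum_succ {Ω : Type u} (ζ : ℤ → Ω → ℝ) (t : ℤ) (g : ℤ → Ω → ℝ) (n : ℕ) :
    partialSum ζ t g (n + 1) =
      fun ω => partialSum ζ t g n ω + g (t - (n : ℤ)) ω * ζ (t - (n : ℤ)) ω := by
  funext ω
  rw [partialSum, Finset.sum_range_succ, partialSum]

lemma aestronglyMeasurable_partialSum {t : ℤ} {g : ℤ → Ω → ℝ}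
    (hg : ∀ s ≤ t, AEStronglyMeasurable[sigmaGen ζ (Set.Icc (s + 1) t)] (g s) P) (n : ℕ) :
    AEStronglyMeasurable[sigmaGen ζ (Set.Icc (t - n + 1) t)] (partialSum ζ t g n) P := by
  induction n with
  | zero =>
    rw [partialSum_zero]
    exact aestronglyMeasurable_const
  | succ n ih =>
    rw [partialSum_succ]
    refine (ih.mono (sigmaGen_mono (Set.Icc_subset_Icc (by lia) le_rfl))).add (.mul ?_ ?_)
    · exact (hg _ (by lia)).mono (sigmaGen_mono (Set.Icc_subset_Icc (by lia) le_rfl))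
    · exact (stronglyMeasurable_sigmaGen (by simp)).aestronglyMeasurable

/-- The partial sums form a martingale as more of the past innovations are revealed, so the
squared `L^p` norm of a partial sum is controlled by those of its increments. -/
lemma absMoment_partialSum_le [IsProbabilityMeasure P] (h : IsInnovation P ζ) {p : ℝ} (hp : 2 ≤ p)
    (hζ : absMoment P p (ζ 0) < ∞) {t : ℤ} {g : ℤ → Ω → ℝ}
    (hg : ∀ s ≤ t, AEStronglyMeasurable[sigmaGen ζ (Set.Icc (s + 1) t)] (g s) P)
    (hgp : ∀ s ≤ t, absMoment P p (g s) < ∞) (n : ℕ) :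
    absMoment P p (partialSum ζ t g n) < ∞ ∧
      absMoment P p (partialSum ζ t g n) ^ (2 / p) ≤
        ENNReal.ofReal (2 * (p ^ 2 * 2 ^ p)) * absMoment P p (ζ 0) ^ (2 / p) *
          ∑ k ∈ Finset.range n, absMoment P p (g (t - (k : ℤ))) ^ (2 / p) := by
  have hp0 : 0 < p := by linarith
  induction n with
  | zero =>
    have : absMoment P p (partialSum ζ t g 0) = 0 := by
      rw [partialSum_zero, absMoment_zero hp0]
    rw [this]
    simp [hp0]
  | succ n ih =>
    obtain ⟨ih1, ih2⟩ := ih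
    have hle : t - (n : ℤ) ≤ t := by omega
    have hd := h.absMoment_coeff_mul hp0.le (hg _ hle)
    have hdp : absMoment P p (fun ω => g (t - (n : ℤ)) ω * ζ (t - (n : ℤ)) ω) < ∞ := by
      rw [hd]; exact ENNReal.mul_lt_top (hgp _ hle) hζ
    have hX := aestronglyMeasurable_partialSum hg n
    have hstep := absMoment_add_increment_le hp (sigmaGen_le h.measurable _) hX (hg _ hle)
      (h.measurable _) (h.indep_sigmaGen (by simp)) (h.integral_eq_zero _) ih1 hdp
    rw [partialSum_succ]
    refine ⟨?_, ?_⟩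
    · exact (absMoment_add_le (by linarith) (hX.mono (sigmaGen_le h.measurable _))).trans_lt
        (ENNReal.mul_lt_top (ENNReal.rpow_lt_top_of_nonneg (by linarith) (by norm_num))
          (ENNReal.add_lt_top.2 ⟨ih1, hdp⟩))
    · refine hstep.trans ?_
      rw [Finset.sum_range_succ, mul_add, hd, ENNReal.mul_rpow_of_nonneg _ _ (by positivity)]
      refine add_le_add ih2 (le_of_eq ?_)
      ring

/-- Fatou's lemma along a subsequence that converges almost surely. -/
lemma absMoment_le_of_partialSum_le {p : ℝ} {t : ℤ} {g : ℤ → Ω → ℝ} {Z : Ω → ℝ}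
    {B : ℝ≥0∞} (hm : ∀ n, AEStronglyMeasurable (partialSum ζ t g n) P)
    (hZ : AEStronglyMeasurable Z P) (hlim : IsMeanSquareSum P ζ t g Z)
    (hB : ∀ n, absMoment P p (partialSum ζ t g n) ≤ B) : absMoment P p Z ≤ B := by
  have hL2 : Tendsto (fun n => eLpNorm (partialSum ζ t g n - Z) 2 P) atTop (𝓝 0) := by
    refine hlim.congr fun n => ?_
    rw [← eLpNorm_neg]
    congr 1
    funext ω
    simp [partialSum]
  obtain ⟨ns, -, hns⟩ :=
    (tendstoInMeasure_of_tendsto_eLpNorm (by norm_num) hm hZ hL2).exists_seq_tendsto_ae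
  calc absMoment P p Z
      = ∫⁻ ω, liminf (fun i => ‖partialSum ζ t g (ns i) ω‖ₑ ^ p) atTop ∂P := by
        refine lintegral_congr_ae (hns.mono fun ω hω => ?_)
        refine (Tendsto.liminf_eq ?_).symm
        exact ((ENNReal.continuous_rpow_const (y := p)).tendsto _).comp
          ((continuous_enorm.tendsto _).comp hω)
    _ ≤ liminf (fun i => absMoment P p (partialSum ζ t g (ns i))) atTop :=
        lintegral_liminf_le' fun i => (hm (ns i)).enorm.pow_const p
    _ ≤ B := liminf_le_of_frequently_le' (Frequently.of_forall fun i => hB _)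

/-- The constant comes from the two-smoothness of `L^p` and depends on `p` alone. -/
theorem exists_isRosenthalConstant {p : ℝ} (hp : 2 ≤ p) :
    ∃ C : ℝ≥0, IsRosenthalConstant.{u} p C := by
  have hp0 : 0 < p := by linarith
  set K : ℝ≥0∞ := ENNReal.ofReal (2 * (p ^ 2 * 2 ^ p)) with hK
  have hCtop : (2 : ℝ≥0∞) ^ (p - 1) * (1 + K ^ (p / 2)) ≠ ∞ :=
    ENNReal.mul_ne_top (ENNReal.rpow_ne_top_of_nonneg (by linarith) (by norm_num))
      (ENNReal.add_ne_top.2 ⟨by simp,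
        ENNReal.rpow_ne_top_of_nonneg (by linarith) ENNReal.ofReal_ne_top⟩)
  refine ⟨((2 : ℝ≥0∞) ^ (p - 1) * (1 + K ^ (p / 2))).toNNReal, ?_⟩
  intro Ω _ P _ ζ h Y g hY hζ t hS
  rw [ENNReal.coe_toNNReal hCtop]
  set S := ∑' k : ℕ, absMoment P p (g (t - (k : ℤ)) t) ^ (2 / p)
  set μ := absMoment P p (ζ 0)
  have hg : ∀ s ≤ t, AEStronglyMeasurable[sigmaGen ζ (Set.Icc (s + 1) t)] (g s t) P :=
    fun s hs => hY.coeff_aestronglyMeasurable hs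
  have hgp : ∀ s ≤ t, absMoment P p (g s t) < ∞ := by
    intro s hs
    have h1 := (ENNReal.le_tsum (f := fun k : ℕ => absMoment P p (g (t - (k : ℤ)) t) ^ (2 / p))
      (t - s).toNat).trans_lt hS
    rw [show t - ((t - s).toNat : ℤ) = s by omega] at h1
    exact (ENNReal.rpow_lt_top_iff_of_pos (by positivity)).1 h1
  have hB : ∀ n, absMoment P p (partialSum ζ t (fun s => g s t) n) ≤
      K ^ (p / 2) * (μ * S ^ (p / 2)) := by
    intro n
    have h1 := (absMoment_partialSum_le h hp hζ hg hgp n).2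
    have h2 : K * μ ^ (2 / p) * ∑ k ∈ Finset.range n, absMoment P p (g (t - (k : ℤ)) t) ^ (2 / p) ≤
        K * μ ^ (2 / p) * S := by
      gcongr
      exact ENNReal.sum_le_tsum _
    have h3 := ENNReal.rpow_le_rpow (h1.trans h2) (show 0 ≤ p / 2 by positivity)
    rwa [← ENNReal.rpow_mul, ENNReal.mul_rpow_of_nonneg _ _ (by positivity),
      ENNReal.mul_rpow_of_nonneg _ _ (by positivity), ← ENNReal.rpow_mul,
      show 2 / p * (p / 2) = 1 by field_simp, ENNReal.rpow_one, ENNReal.rpow_one, mul_assoc] at h3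
  have hYm : AEStronglyMeasurable (fun ω => Y t ω - ∫ ω', Y t ω' ∂P) P :=
    (hY.memLp t).1.sub aestronglyMeasurable_const
  have hc := absMoment_le_of_partialSum_le
    (fun n => (aestronglyMeasurable_partialSum hg n).mono (sigmaGen_le h.measurable _))
    hYm (hY.expansion t) hB
  have hadd := absMoment_add_le (P := P) (p := p) (by linarith)
    (g := fun _ => ∫ ω', Y t ω' ∂P) hYm
  simp only [sub_add_cancel, absMoment_const] at hadd
  refine hadd.trans ?_
  rw [mul_assoc]
  gcongr
  rw [add_mul, one_mul, mul_add]
  calc _ ≤ K ^ (p / 2) * (μ * S ^ (p / 2)) + ‖∫ ω', Y t ω' ∂P‖ₑ ^ p := by gcongr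
    _ = ‖∫ ω', Y t ω' ∂P‖ₑ ^ p + K ^ (p / 2) * (μ * S ^ (p / 2)) := add_comm _ _
    _ ≤ _ := add_le_add le_self_add le_add_self

end Rosenthal

/-! ### Projections of mean-square sums -/

section Projection

variable {Ω : Type u} [m0 : MeasurableSpace Ω] {P : Measure Ω} {ζ : ℤ → Ω → ℝ}

lemma IsInnovation.memLp_coeff_mul (h : IsInnovation P ζ) {s t : ℤ} {g : Ω → ℝ}
    (hg : AEStronglyMeasurable[sigmaGen ζ (Set.Icc (s + 1) t)] g P)
    (hg2 : absMoment P 2 g < ∞) : MemLp (fun ω => g ω * ζ s ω) 2 P := by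
  refine memLp_two_of_absMoment_lt_top
    ((hg.mono (sigmaGen_le h.measurable _)).mul (h.measurable s).aestronglyMeasurable) ?_
  rw [h.absMoment_coeff_mul (by norm_num) hg]
  refine ENNReal.mul_lt_top hg2 ?_
  rw [absMoment_two_eq_eLpNorm_sq]
  exact ENNReal.pow_lt_top h.memLp.2

variable [IsProbabilityMeasure P]

/-- The summand with index `s` is centred given innovations later than `s`. -/
lemma IsInnovation.condExp_coeff_mul (h : IsInnovation P ζ) {s t : ℤ} {g : Ω → ℝ}
    (hg : AEStronglyMeasurable[sigmaGen ζ (Set.Icc (s + 1) t)] g P)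
    (hg2 : absMoment P 2 g < ∞) {S : Set ℤ} (hS : S ⊆ Set.Icc (s + 1) t) :
    P[fun ω => g ω * ζ s ω | sigmaGen ζ S] =ᵐ[P] fun _ => 0 := by
  have hle := sigmaGen_le h.measurable (Set.Icc (s + 1) t)
  have h1 : P[ζ s | sigmaGen ζ (Set.Icc (s + 1) t)] =ᵐ[P] fun _ => ∫ ω, ζ s ω ∂P :=
    condExp_indep_eq (h.measurable s).comap_le hle
      (measurable_iff_comap_le.2 le_rfl).stronglyMeasurable (h.indep_sigmaGen (by simp)).symm
  have h2 : P[fun ω => g ω * ζ s ω | sigmaGen ζ (Set.Icc (s + 1) t)] =ᵐ[P] fun _ => 0 := by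
    refine (condExp_mul_of_aestronglyMeasurable_left hg
      ((h.memLp_coeff_mul hg hg2).integrable (by norm_num))
      ((h.memLp_two s).integrable (by norm_num))).trans ?_
    filter_upwards [h1] with ω hω
    rw [Pi.mul_apply, hω, h.integral_eq_zero, mul_zero]
  have h3 := condExp_condExp_of_le (μ := P) (f := fun ω => g ω * ζ s ω) (sigmaGen_mono hS) hle
  refine h3.symm.trans ((condExp_congr_ae h2).trans ?_)
  rw [condExp_const (sigmaGen_le h.measurable S)]

lemma memLp_partialSum (h : IsInnovation P ζ) {t : ℤ} {g : ℤ → Ω → ℝ}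
    (hg : ∀ s ≤ t, AEStronglyMeasurable[sigmaGen ζ (Set.Icc (s + 1) t)] (g s) P)
    (hg2 : ∀ s ≤ t, absMoment P 2 (g s) < ∞) (n : ℕ) : MemLp (partialSum ζ t g n) 2 P := by
  induction n with
  | zero => rw [partialSum_zero]; exact memLp_const 0
  | succ n ih =>
    rw [partialSum_succ]
    exact ih.add (h.memLp_coeff_mul (hg _ (by lia)) (hg2 _ (by lia)))

lemma condExp_partialSum (h : IsInnovation P ζ) {t : ℤ} {g : ℤ → Ω → ℝ}
    (hg : ∀ s ≤ t, AEStronglyMeasurable[sigmaGen ζ (Set.Icc (s + 1) t)] (g s) P)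
    (hg2 : ∀ s ≤ t, absMoment P 2 (g s) < ∞) {n m : ℕ} (hnm : n ≤ m) :
    P[partialSum ζ t g m | sigmaGen ζ (Set.Icc (t - n + 1) t)] =ᵐ[P] partialSum ζ t g n := by
  induction m, hnm using Nat.le_induction with
  | base =>
    exact condExp_of_aestronglyMeasurable' (sigmaGen_le h.measurable _)
      (aestronglyMeasurable_partialSum hg n)
      ((memLp_partialSum h hg hg2 n).integrable (by norm_num))
  | succ m hm ih =>
    rw [partialSum_succ]
    have hmt : t - (m : ℤ) ≤ t := by lia
    refine (condExp_add ((memLp_partialSum h hg hg2 m).integrable (by norm_num))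
      ((h.memLp_coeff_mul (hg _ hmt) (hg2 _ hmt)).integrable (by norm_num)) _).trans ?_
    filter_upwards [ih, h.condExp_coeff_mul (hg _ hmt) (hg2 _ hmt)
      (Set.Icc_subset_Icc_left (by lia : t - (m : ℤ) + 1 ≤ t - n + 1))] with ω h1 h2
    rw [Pi.add_apply, h1, h2, add_zero]

lemma integral_partialSum (h : IsInnovation P ζ) {t : ℤ} {g : ℤ → Ω → ℝ}
    (hg : ∀ s ≤ t, AEStronglyMeasurable[sigmaGen ζ (Set.Icc (s + 1) t)] (g s) P)
    (hg2 : ∀ s ≤ t, absMoment P 2 (g s) < ∞) (n : ℕ) : ∫ ω, partialSum ζ t g n ω ∂P = 0 := by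
  have h1 := condExp_partialSum h hg hg2 n.zero_le
  rw [partialSum_zero] at h1
  rw [← integral_condExp (sigmaGen_le h.measurable (Set.Icc (t - (0 : ℕ) + 1) t)),
    integral_congr_ae h1, integral_zero]

/-- Projecting a mean-square sum on the innovations in a finite window truncates it. -/
lemma condExp_of_isMeanSquareSum (h : IsInnovation P ζ) {t : ℤ} {g : ℤ → Ω → ℝ} {Z : Ω → ℝ}
    (hg : ∀ s ≤ t, AEStronglyMeasurable[sigmaGen ζ (Set.Icc (s + 1) t)] (g s) P)
    (hg2 : ∀ s ≤ t, absMoment P 2 (g s) < ∞) (hZ : MemLp Z 2 P)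
    (hlim : IsMeanSquareSum P ζ t g Z) (n : ℕ) :
    P[Z | sigmaGen ζ (Set.Icc (t - n + 1) t)] =ᵐ[P] partialSum ζ t g n := by
  have hbound : ∀ᶠ m : ℕ in atTop,
      eLpNorm (fun ω => (P[Z | sigmaGen ζ (Set.Icc (t - n + 1) t)]) ω - partialSum ζ t g n ω) 1 P ≤
        eLpNorm (fun ω => Z ω - partialSum ζ t g m ω) 2 P := by
    filter_upwards [eventually_ge_atTop n] with m hm
    have hpm := memLp_partialSum h hg hg2 m
    have h1 : P[Z - partialSum ζ t g m | sigmaGen ζ (Set.Icc (t - n + 1) t)] =ᵐ[P]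
        fun ω => (P[Z | sigmaGen ζ (Set.Icc (t - n + 1) t)]) ω - partialSum ζ t g n ω := by
      refine (condExp_sub (hZ.integrable (by norm_num)) (hpm.integrable (by norm_num)) _).trans ?_
      filter_upwards [condExp_partialSum h hg hg2 hm] with ω hω
      rw [Pi.sub_apply, hω]
    rw [← eLpNorm_congr_ae h1]
    exact (eLpNorm_condExp_le_eLpNorm _ le_rfl).trans
      (eLpNorm_le_eLpNorm_of_exponent_le (by norm_num) (hZ.sub hpm).1)
  have h0 := le_antisymm (ge_of_tendsto hlim hbound) zero_le
  have hm : AEStronglyMeasurable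
      (fun ω => (P[Z | sigmaGen ζ (Set.Icc (t - n + 1) t)]) ω - partialSum ζ t g n ω) P :=
    integrable_condExp.1.sub (memLp_partialSum h hg hg2 n).1
  filter_upwards [(eLpNorm_eq_zero_iff hm one_ne_zero).1 h0] with ω hω
  exact sub_eq_zero.1 hω

lemma integral_eq_zero_of_isMeanSquareSum (h : IsInnovation P ζ) {t : ℤ} {g : ℤ → Ω → ℝ}
    {Z : Ω → ℝ}
    (hg : ∀ s ≤ t, AEStronglyMeasurable[sigmaGen ζ (Set.Icc (s + 1) t)] (g s) P)
    (hg2 : ∀ s ≤ t, absMoment P 2 (g s) < ∞) (hZ : MemLp Z 2 P)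
    (hlim : IsMeanSquareSum P ζ t g Z) : ∫ ω, Z ω ∂P = 0 := by
  have h1 := condExp_of_isMeanSquareSum h hg hg2 hZ hlim 0
  rw [partialSum_zero] at h1
  rw [← integral_condExp (sigmaGen_le h.measurable (Set.Icc (t - (0 : ℕ) + 1) t)),
    integral_congr_ae h1, integral_zero]

end Projection

/-! ### The Rosenthal inequality for finite expansions -/

section FiniteExpansion

variable {Ω : Type u} [m0 : MeasurableSpace Ω] {P : Measure Ω} [IsProbabilityMeasure P]
  {ζ : ℤ → Ω → ℝ}

lemma partialSum_truncate_of_le {Ω : Type u} (ζ : ℤ → Ω → ℝ) (t : ℤ) (g : ℤ → Ω → ℝ) {n m : ℕ}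
    (hnm : n ≤ m) :
    partialSum ζ t (fun s => if t - n < s then g s else fun _ => 0) m = partialSum ζ t g n := by
  funext ω
  rw [partialSum, partialSum, ← Finset.sum_subset (Finset.range_mono hnm)]
  · refine Finset.sum_congr rfl fun k hk => ?_
    have := Finset.mem_range.1 hk
    rw [if_pos (by lia)]
  · intro k _ hk
    have : ¬ k < n := fun hk' => hk (Finset.mem_range.2 hk')
    rw [if_neg (by lia), zero_mul]

/-- A finite expansion at one time `t` is extended by zero to all times, so that it becomes a
projective process. -/
lemma IsRosenthalConstant.absMoment_add_partialSum_le {p : ℝ} {C : ℝ≥0}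
    (hC : IsRosenthalConstant.{u} p C) (hp : 0 < p) (h : IsInnovation P ζ)
    (hζ : absMoment P p (ζ 0) < ∞) {t : ℤ} {g : ℤ → Ω → ℝ} (a : ℝ) (n : ℕ)
    (hg : ∀ s ≤ t, AEStronglyMeasurable[sigmaGen ζ (Set.Icc (s + 1) t)] (g s) P)
    (hgt : ∃ b : ℝ, g t =ᵐ[P] fun _ => b)
    (hg2 : ∀ s ≤ t, absMoment P 2 (g s) < ∞)
    (hgp : ∀ k < n, absMoment P p (g (t - (k : ℤ))) < ∞) :
    absMoment P p (fun ω => a + partialSum ζ t g n ω) ≤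
      C * (‖a‖ₑ ^ p + absMoment P p (ζ 0) *
        (∑ k ∈ Finset.range n, absMoment P p (g (t - (k : ℤ))) ^ (2 / p)) ^ (p / 2)) := by
  set G : ℤ → Ω → ℝ := fun s => if t - n < s then g s else fun _ => 0 with hGdef
  set Y : ℤ → Ω → ℝ := fun τ => if τ = t then fun ω => a + partialSum ζ t g n ω else fun _ => 0
    with hYdef
  set g' : ℤ → ℤ → Ω → ℝ := fun s τ => if τ = t then G s else fun _ => 0 with hg'def
  have hsum : ∀ N : (Ω → ℝ) → ℝ≥0∞, N (fun _ => 0) = 0 →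
      ∑' k : ℕ, N (G (t - (k : ℤ))) = ∑ k ∈ Finset.range n, N (g (t - (k : ℤ))) := by
    intro N hN
    rw [tsum_eq_sum (s := Finset.range n)]
    · refine Finset.sum_congr rfl fun k hk => ?_
      have := Finset.mem_range.1 hk
      simp only [hGdef, show t - (n : ℤ) < t - k by lia, if_true]
    · intro k hk
      have : ¬ k < n := fun hk' => hk (Finset.mem_range.2 hk')
      simp only [hGdef, show ¬ t - (n : ℤ) < t - k by lia, if_false, hN]
  have hN : absMoment P p (fun _ => (0 : ℝ)) ^ (2 / p) = 0 := by
    rw [absMoment_zero hp, ENNReal.zero_rpow_of_pos (by positivity)]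
  have hmem := memLp_partialSum h hg hg2 n
  have hmean : ∫ ω, partialSum ζ t g n ω ∂P = 0 := integral_partialSum h hg hg2 n
  have hYt : ∫ ω, (a + partialSum ζ t g n ω) ∂P = a := by
    rw [integral_add (integrable_const a) (hmem.integrable (by norm_num)), hmean]
    simp
  have hY : IsProjectiveWith P ζ Y g' := by
    refine ⟨fun τ => ?_, fun τ => ?_, fun s τ hs => ?_, fun τ => ?_, fun τ => ?_, fun τ => ?_⟩
    all_goals rcases eq_or_ne τ t with rfl | hτ
    all_goals first
      | simp only [hYdef, hg'def, hτ, if_false]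
      | simp only [hYdef, hg'def, if_true]
    · exact (memLp_const a).add hmem
    · exact memLp_const 0
    · exact aestronglyMeasurable_const.add
        ((aestronglyMeasurable_partialSum hg n).mono (sigmaGen_mono Set.Icc_subset_Iic_self))
    · exact aestronglyMeasurable_const
    · simp only [hGdef]
      split_ifs
      · exact hg s hs.le
      · exact aestronglyMeasurable_const
    · exact aestronglyMeasurable_const
    · simp only [hGdef]
      split_ifs
      · exact hgt
      · exact ⟨0, ae_eq_rfl⟩
    · exact ⟨0, ae_eq_rfl⟩
    · rw [hsum (absMoment P 2) (absMoment_zero (by norm_num))]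
      exact ENNReal.sum_lt_top.2 fun k _ => hg2 _ (by lia)
    · simp [absMoment_zero]
    · rw [hYt]
      refine tendsto_const_nhds.congr' ?_
      filter_upwards [eventually_ge_atTop n] with m hm
      have h1 := partialSum_truncate_of_le ζ τ g hm
      have h2 : (fun ω => a + partialSum ζ τ g n ω - a -
          ∑ k ∈ Finset.range m, G (τ - (k : ℤ)) ω * ζ (τ - (k : ℤ)) ω) = fun _ => 0 := by
        funext ω
        rw [← congrFun h1 ω, partialSum]
        ring
      rw [h2]
      exact eLpNorm_zero'.symm
    · simp [IsMeanSquareSum]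
  have hfin : ∑ k ∈ Finset.range n, absMoment P p (g (t - (k : ℤ))) ^ (2 / p) < ∞ :=
    ENNReal.sum_lt_top.2 fun k hk => ENNReal.rpow_lt_top_of_nonneg (by positivity)
      (hgp k (Finset.mem_range.1 hk)).ne
  have key := hC Ω P ζ h Y g' hY hζ t (by
    simp only [hg'def, if_true]
    rwa [hsum (fun f => absMoment P p f ^ (2 / p)) hN])
  simp only [hg'def, hYdef, if_true] at key
  rwa [hsum (fun f => absMoment P p f ^ (2 / p)) hN, hYt] at key

end FiniteExpansion

/-! ### Solutions of the projective equation -/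

section Solution

lemma sum_Ioc_eq_sum_range {M : Type*} [AddCommMonoid M] (t : ℤ) (i : ℕ) (F : ℤ → M) :
    ∑ v ∈ Finset.Ioc (t - i) t, F v = ∑ k ∈ Finset.range i, F (t - (k : ℤ)) := by
  symm
  refine Finset.sum_nbij' (fun k => t - (k : ℤ)) (fun v => (t - v).toNat) ?_ ?_ ?_ ?_ ?_
  · intro k hk
    have := Finset.mem_range.1 hk
    exact Finset.mem_Ioc.2 ⟨by lia, by lia⟩
  · intro v hv
    have := Finset.mem_Ioc.1 hv
    exact Finset.mem_range.2 (by lia)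
  · intro k _
    lia
  · intro v hv
    have := Finset.mem_Ioc.1 hv
    lia
  · intro k _
    rfl

variable {Ω : Type u} [m0 : MeasurableSpace Ω] {P : Measure Ω} {ζ : ℤ → Ω → ℝ} {m : ℝ}
  {Q : ℝ → ℝ} {α : ℕ → ℝ} {β : ℕ → ℕ → ℝ} {X : ℤ → Ω → ℝ}

lemma aestronglyMeasurable_kernelCoeff (hQ : Measurable Q) (s t : ℤ) :
    AEStronglyMeasurable[sigmaGen ζ (Set.Icc (s + 1) t)] (kernelCoeff P ζ Q α β X s t) P := by
  have hproj : ∀ v, s + 1 ≤ v →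
      StronglyMeasurable[sigmaGen ζ (Set.Icc (s + 1) t)] (proj P ζ v t (X t)) := fun v hv =>
    stronglyMeasurable_condExp.mono (sigmaGen_mono (Set.Icc_subset_Icc_left hv))
  have hsum : StronglyMeasurable[sigmaGen ζ (Set.Icc (s + 1) t)]
      (fun ω => ∑ v ∈ Finset.Ioc s t, β (t - v).toNat (v - s).toNat *
        (proj P ζ v t (X t) ω - proj P ζ (v + 1) t (X t) ω)) := by
    refine Finset.stronglyMeasurable_fun_sum _ fun v hv => ?_
    have hv := Finset.mem_Ioc.1 hv
    exact ((hproj v (by lia)).sub (hproj (v + 1) (by lia))).const_mul _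
  exact (hQ.comp (stronglyMeasurable_const.add hsum).measurable).aestronglyMeasurable

lemma kernelCoeff_self (t : ℤ) : kernelCoeff P ζ Q α β X t t = fun _ => Q (α 0) := by
  funext ω
  simp [kernelCoeff]

lemma IsSolution.memLp (hX : IsSolution P ζ m Q α β X) (t : ℤ) : MemLp (X t) 2 P :=
  hX.projective.choose_spec.memLp t

lemma IsSolution.absMoment_two_lt_top (hX : IsSolution P ζ m Q α β X) {s t : ℤ} (hst : s ≤ t) :
    absMoment P 2 (kernelCoeff P ζ Q α β X s t) < ∞ := by
  have h1 := (ENNReal.le_tsum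
    (f := fun k : ℕ => absMoment P 2 (kernelCoeff P ζ Q α β X (t - (k : ℤ)) t))
    (t - s).toNat).trans_lt (hX.kernel_sum t)
  rwa [show t - ((t - s).toNat : ℤ) = s by lia] at h1

variable [IsProbabilityMeasure P]

lemma IsSolution.proj_eq (h : IsInnovation P ζ) (hQ : Measurable Q)
    (hX : IsSolution P ζ m Q α β X) (t : ℤ) (n : ℕ) :
    proj P ζ (t - n + 1) t (X t) =ᵐ[P]
      fun ω => partialSum ζ t (fun s => kernelCoeff P ζ Q α β X s t) n ω + m := by
  have hle := sigmaGen_le h.measurable (Set.Icc (t - n + 1) t)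
  have h1 := condExp_of_isMeanSquareSum h (fun s _ => aestronglyMeasurable_kernelCoeff hQ s t)
    (fun s hs => hX.absMoment_two_lt_top hs) ((hX.memLp t).sub (memLp_const m)) (hX.equation t) n
  have h2 := condExp_sub ((hX.memLp t).integrable (by norm_num)) (integrable_const m)
    (sigmaGen ζ (Set.Icc (t - n + 1) t))
  rw [condExp_const hle] at h2
  filter_upwards [h1, h2] with ω hω1 hω2
  have h3 := hω2.symm.trans hω1
  rw [Pi.sub_apply] at h3
  exact sub_eq_iff_eq_add.1 h3

/-- The innovation of `X t` at time `t - k` is the corresponding summand of the equation. -/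
lemma IsSolution.proj_sub_proj (h : IsInnovation P ζ) (hQ : Measurable Q)
    (hX : IsSolution P ζ m Q α β X) (t : ℤ) (k : ℕ) :
    (fun ω => proj P ζ (t - k) t (X t) ω - proj P ζ (t - k + 1) t (X t) ω) =ᵐ[P]
      fun ω => kernelCoeff P ζ Q α β X (t - k) t ω * ζ (t - k) ω := by
  have h1 := hX.proj_eq h hQ t (k + 1)
  rw [partialSum_succ, show t - ((k + 1 : ℕ) : ℤ) + 1 = t - k by push_cast; ring] at h1
  filter_upwards [h1, hX.proj_eq h hQ t k] with ω hω1 hω2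
  rw [hω1, hω2]
  ring

/-- The coefficients of a solution solve a closed recursion, in which no projection occurs. -/
lemma IsSolution.kernelCoeff_recursion (h : IsInnovation P ζ) (hQ : Measurable Q)
    (hX : IsSolution P ζ m Q α β X) (t : ℤ) (i : ℕ) :
    kernelCoeff P ζ Q α β X (t - i) t =ᵐ[P] fun ω => Q (α i + partialSum ζ t
      (fun s ω => β (t - s).toNat (s - (t - i)).toNat * kernelCoeff P ζ Q α β X s t ω) i ω) := by
  filter_upwards [ae_all_iff.2 fun k : ℕ => hX.proj_sub_proj h hQ t k] with ω hω
  rw [kernelCoeff, sum_Ioc_eq_sum_range, partialSum, show (t - (t - (i : ℤ))).toNat = i by lia]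
  congr 2
  refine Finset.sum_congr rfl fun k _ => ?_
  rw [hω k, mul_assoc]

lemma IsSolution.integral_sub_const_eq_zero (h : IsInnovation P ζ) (hQ : Measurable Q)
    (hX : IsSolution P ζ m Q α β X) (t : ℤ) : ∫ ω, (X t ω - m) ∂P = 0 :=
  integral_eq_zero_of_isMeanSquareSum h (fun s _ => aestronglyMeasurable_kernelCoeff hQ s t)
    (fun _ hs => hX.absMoment_two_lt_top hs) ((hX.memLp t).sub (memLp_const m)) (hX.equation t)

lemma IsSolution.isProjectiveWith_sub_const (h : IsInnovation P ζ) (hQ : Measurable Q)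
    (hX : IsSolution P ζ m Q α β X) :
    IsProjectiveWith P ζ (fun t ω => X t ω - m) (kernelCoeff P ζ Q α β X) where
  memLp t := (hX.memLp t).sub (memLp_const m)
  adapted t := (hX.projective.choose_spec.adapted t).sub aestronglyMeasurable_const
  coeff_measurable _ _ _ := aestronglyMeasurable_kernelCoeff hQ _ _
  coeff_diag t := ⟨Q (α 0), by rw [kernelCoeff_self]⟩
  coeff_sum t := hX.kernel_sum t
  expansion t := by
    rw [hX.integral_sub_const_eq_zero h hQ]
    simpa using hX.equation t

/-- With `a_i = ‖Q_{t-i,t}‖_p²`, the Rosenthal inequality turns the recursion for the coefficients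
into `a_i ≤ c² C^{2/p} (α_i² + μ_p^{2/p} ∑_{j < i} β_{j,i-j}² a_j)`. -/
lemma IsSolution.absMoment_kernelCoeff_le {p : ℝ} {C : ℝ≥0} (hC : IsRosenthalConstant.{u} p C)
    (hp : 2 ≤ p) (h : IsInnovation P ζ) (hζ : absMoment P p (ζ 0) < ∞) (hQ : Measurable Q)
    {c : ℝ} (hc : 0 < c) (hQc : ∀ x, |Q x| ≤ c * |x|) (hX : IsSolution P ζ m Q α β X)
    (t : ℤ) (i : ℕ) (hfin : ∀ k < i, absMoment P p (kernelCoeff P ζ Q α β X (t - k) t) < ∞) :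
    absMoment P p (kernelCoeff P ζ Q α β X (t - i) t) ^ (2 / p) ≤
      ENNReal.ofReal c ^ 2 * (C : ℝ≥0∞) ^ (2 / p) * (ENNReal.ofReal (α i ^ 2) +
        absMoment P p (ζ 0) ^ (2 / p) * ∑ k ∈ Finset.range i, ENNReal.ofReal (β k (i - k) ^ 2) *
          absMoment P p (kernelCoeff P ζ Q α β X (t - k) t) ^ (2 / p)) := by
  have hp0 : 0 < p := by linarith
  have hsq : ∀ x : ℝ, (‖x‖ₑ ^ p) ^ (2 / p) = ENNReal.ofReal (x ^ 2) := by
    intro x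
    rw [← ENNReal.rpow_mul, show p * (2 / p) = 2 by field_simp, ENNReal.rpow_two,
      ← sq_abs, ENNReal.ofReal_pow (abs_nonneg x), Real.enorm_eq_ofReal_abs]
  set q : ℤ → Ω → ℝ := fun s => kernelCoeff P ζ Q α β X s t with hq
  set g : ℤ → Ω → ℝ := fun s ω => β (t - s).toNat (s - (t - i)).toNat * q s ω with hg
  have hgp : ∀ (r : ℝ), 0 ≤ r → ∀ s, absMoment P r (g s) =
      ‖β (t - s).toNat (s - (t - i)).toNat‖ₑ ^ r * absMoment P r (q s) := fun r hr s =>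
    absMoment_const_mul hr _ _
  have hros := hC.absMoment_add_partialSum_le hp0 h hζ (t := t) (g := g) (α i) i
    (fun s _ => (aestronglyMeasurable_kernelCoeff hQ s t).const_mul _)
    ⟨β (t - t).toNat (t - (t - i)).toNat * Q (α 0), by
      rw [hg, hq]; simp only [kernelCoeff_self]; exact ae_eq_rfl⟩
    (fun s hs => by
      rw [hgp 2 (by norm_num)]
      exact ENNReal.mul_lt_top (by simp) (hX.absMoment_two_lt_top hs))
    (fun k hk => by
      rw [hgp p hp0.le]
      exact ENNReal.mul_lt_top (ENNReal.rpow_lt_top_of_nonneg hp0.le enorm_ne_top) (hfin k hk))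
  have hsum : ∑ k ∈ Finset.range i, absMoment P p (g (t - (k : ℤ))) ^ (2 / p) =
      ∑ k ∈ Finset.range i, ENNReal.ofReal (β k (i - k) ^ 2) *
        absMoment P p (q (t - (k : ℤ))) ^ (2 / p) := by
    refine Finset.sum_congr rfl fun k hk => ?_
    have := Finset.mem_range.1 hk
    rw [hgp p hp0.le, ENNReal.mul_rpow_of_nonneg _ _ (by positivity), hsq,
      show (t - (t - (k : ℤ))).toNat = k by lia,
      show (t - (k : ℤ) - (t - (i : ℤ))).toNat = i - k by lia]
  rw [hsum] at hros
  set S := ∑ k ∈ Finset.range i, ENNReal.ofReal (β k (i - k) ^ 2) *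
        absMoment P p (q (t - (k : ℤ))) ^ (2 / p)
  have hle : absMoment P p (q (t - i)) ≤
      ENNReal.ofReal c ^ p * absMoment P p (fun ω => α i + partialSum ζ t g i ω) := by
    rw [absMoment_congr (hX.kernelCoeff_recursion h hQ t i), ← abs_of_pos hc,
      ← Real.enorm_eq_ofReal_abs, ← absMoment_const_mul hp0.le]
    refine lintegral_mono fun ω => ENNReal.rpow_le_rpow ?_ hp0.le
    rw [Real.enorm_eq_ofReal_abs, Real.enorm_eq_ofReal_abs, abs_mul, abs_of_pos hc]
    exact ENNReal.ofReal_le_ofReal (hQc _)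
  calc absMoment P p (q (t - i)) ^ (2 / p)
      ≤ (ENNReal.ofReal c ^ p * (C * (‖α i‖ₑ ^ p + absMoment P p (ζ 0) * S ^ (p / 2)))) ^ (2 / p) :=
        ENNReal.rpow_le_rpow (hle.trans (by gcongr)) (by positivity)
    _ = ENNReal.ofReal c ^ 2 * C ^ (2 / p) *
          (‖α i‖ₑ ^ p + absMoment P p (ζ 0) * S ^ (p / 2)) ^ (2 / p) := by
        rw [ENNReal.mul_rpow_of_nonneg _ _ (by positivity),
          ENNReal.mul_rpow_of_nonneg _ _ (by positivity), ← ENNReal.rpow_mul,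
          show p * (2 / p) = 2 by field_simp, ENNReal.rpow_two, mul_assoc]
    _ ≤ ENNReal.ofReal c ^ 2 * C ^ (2 / p) *
          (ENNReal.ofReal (α i ^ 2) + absMoment P p (ζ 0) ^ (2 / p) * S) := by
        gcongr
        refine (ENNReal.rpow_add_le_add_rpow _ _ (by positivity)
          ((div_le_one hp0).2 hp)).trans_eq ?_
        rw [hsq, ENNReal.mul_rpow_of_nonneg _ _ (by positivity), ← ENNReal.rpow_mul,
          show p / 2 * (2 / p) = 1 by field_simp, ENNReal.rpow_one]

end Solution

/-! ### Nondegeneracy of Rosenthal constants -/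

/-- A bounded injective function of the innovations, centred and normalised, is an innovation
sequence all of whose moments are finite. -/
lemma IsInnovation.exists_bounded {Ω : Type u} [MeasurableSpace Ω] {P : Measure Ω}
    [IsProbabilityMeasure P] {ζ : ℤ → Ω → ℝ} (h : IsInnovation P ζ) :
    ∃ ζ' : ℤ → Ω → ℝ, IsInnovation P ζ' ∧ ∀ p : ℝ, 0 ≤ p → absMoment P p (ζ' 0) < ∞ := by
  have hm : ∀ s, Measurable fun ω => Real.arctan (ζ s ω) := fun s =>
    Real.measurable_arctan.comp (h.measurable s)
  set e : ℝ := ∫ ω, Real.arctan (ζ 0 ω) ∂P with he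
  have hbd : ∀ x, ‖Real.arctan x‖ ≤ Real.pi / 2 := fun x =>
    abs_le.2 ⟨(Real.neg_pi_div_two_lt_arctan x).le, (Real.arctan_lt_pi_div_two x).le⟩
  have hbd2 : ∀ x, ‖Real.arctan x - e‖ ≤ Real.pi / 2 + ‖e‖ := fun x =>
    (norm_sub_le _ _).trans (by gcongr; exact hbd x)
  have hi : Integrable (fun ω => Real.arctan (ζ 0 ω)) P :=
    Integrable.of_bound (hm 0).aestronglyMeasurable _ (Eventually.of_forall fun ω => hbd _)
  have hL : ∀ r : ℝ≥0∞, MemLp (fun ω => Real.arctan (ζ 0 ω) - e) r P := fun r =>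
    MemLp.of_bound ((hm 0).sub_const e).aestronglyMeasurable _
      (Eventually.of_forall fun ω => hbd2 _)
  set V : ℝ := ∫ ω, (Real.arctan (ζ 0 ω) - e) ^ 2 ∂P with hV
  have hVpos : 0 < V := by
    refine lt_of_le_of_ne (integral_nonneg fun ω => sq_nonneg _) fun h0 => ?_
    have h1 :=
      (integral_eq_zero_iff_of_nonneg (fun ω => sq_nonneg _) (hL 2).integrable_sq).1 h0.symm
    -- if the transform is constant then so is `ζ 0`, by injectivity, and its variance is not `1`
    have h2 : ζ 0 =ᵐ[P] fun _ => Real.tan e := by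
      filter_upwards [h1] with ω hω
      have : Real.arctan (ζ 0 ω) = e := by
        have : (Real.arctan (ζ 0 ω) - e) ^ 2 = 0 := hω
        exact sub_eq_zero.1 (pow_eq_zero_iff (by norm_num) |>.1 this)
      rw [← this, Real.tan_arctan]
    have h3 : Real.tan e = 0 := by
      have h4 := h.mean_zero
      rw [integral_congr_ae h2] at h4
      simpa using h4
    exact h.not_ae_eq_zero (h2.trans (by rw [h3]; exact ae_eq_rfl))
  set f : ℝ → ℝ := fun x => (Real.arctan x - e) / √V with hf
  have hfm : Measurable f := (Real.measurable_arctan.sub_const e).div_const _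
  refine ⟨fun s => f ∘ ζ s, ⟨fun s => hfm.comp (h.measurable s),
    h.indep.comp _ fun _ => hfm, fun s => (h.identDistrib s).comp hfm, ?_, ?_, ?_⟩, fun p hp => ?_⟩
  · simpa only [hf, Function.comp_def, div_eq_mul_inv] using (hL 2).mul_const (√V)⁻¹
  · simp only [hf, Function.comp_apply]
    rw [integral_div, integral_sub hi (integrable_const e), ← he]
    simp
  · simp only [hf, Function.comp_apply, div_pow, Real.sq_sqrt hVpos.le]
    rw [integral_div, ← hV, div_self hVpos.ne']
  · refine (lintegral_mono (g := fun _ => ENNReal.ofReal ((Real.pi / 2 + ‖e‖) / √V) ^ p)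
      fun ω => ENNReal.rpow_le_rpow ?_ hp).trans_lt ?_
    · rw [← ofReal_norm]
      refine ENNReal.ofReal_le_ofReal ?_
      simp only [hf, Function.comp_apply, norm_div, Real.norm_of_nonneg (Real.sqrt_nonneg V)]
      gcongr
      exact hbd2 _
    · simpa using ENNReal.rpow_lt_top_of_nonneg hp ENNReal.ofReal_ne_top

lemma IsRosenthalConstant.ne_zero {p : ℝ} {C : ℝ≥0} (hC : IsRosenthalConstant.{u} p C)
    (hp : 0 < p) {Ω : Type u} [MeasurableSpace Ω] {P : Measure Ω} [IsProbabilityMeasure P]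
    {ζ : ℤ → Ω → ℝ} (h : IsInnovation P ζ) : C ≠ 0 := by
  rintro rfl
  obtain ⟨ζ', h', hfin⟩ := h.exists_bounded
  have h1 := hC.absMoment_add_partialSum_le hp h' (hfin p hp.le) (t := 0) (g := fun _ _ => 1) 0 1
    (fun _ _ => aestronglyMeasurable_const) ⟨1, ae_eq_rfl⟩
    (fun _ _ => by simp [absMoment_const]) (fun _ _ => by simp [absMoment_const])
  have h2 : (fun ω => 0 + partialSum ζ' 0 (fun _ _ => 1) 1 ω) = ζ' 0 := by
    funext ω
    simp [partialSum]
  rw [h2] at h1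
  exact h'.absMoment_ne_zero hp (by simpa using h1)

/-! ### Moments of the solution -/

section MomentBound

variable {Ω : Type u} [m0 : MeasurableSpace Ω] {P : Measure Ω} [IsProbabilityMeasure P]
  {ζ : ℤ → Ω → ℝ} {m : ℝ} {Q : ℝ → ℝ} {α : ℕ → ℝ} {β : ℕ → ℕ → ℝ} {X : ℤ → Ω → ℝ}

lemma IsSolution.absMoment_sub_const_le {p : ℝ} {C : ℝ≥0} (hC : IsRosenthalConstant.{u} p C)
    (hp : 2 ≤ p) (h : IsInnovation P ζ) (hζ : absMoment P p (ζ 0) < ∞) (hQ : Measurable Q)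
    {c : ℝ} (hc : 0 < c) (hQc : ∀ x, |Q x| ≤ c * |x|)
    (hK : KQp p C (absMoment P p (ζ 0)) c α β < ∞) (hX : IsSolution P ζ m Q α β X) (t : ℤ) :
    absMoment P p (fun ω => X t ω - m) ^ (2 / p) ≤ KQp p C (absMoment P p (ζ 0)) c α β := by
  have hp0 : 0 < p := by linarith
  have hfin : ∀ i : ℕ, absMoment P p (kernelCoeff P ζ Q α β X (t - i) t) < ∞ := by
    intro i
    induction i using Nat.strong_induction_on with
    | _ i ih =>
      have h1 := hX.absMoment_kernelCoeff_le hC hp h hζ hQ hc hQc t i ih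
      refine (ENNReal.rpow_lt_top_iff_of_pos (y := 2 / p) (by positivity)).1 (h1.trans_lt ?_)
      refine ENNReal.mul_lt_top (ENNReal.mul_lt_top (by simp)
        (ENNReal.rpow_lt_top_of_nonneg (by positivity) ENNReal.coe_ne_top))
        (ENNReal.add_lt_top.2 ⟨by simp, ENNReal.mul_lt_top
          (ENNReal.rpow_lt_top_of_nonneg (by positivity) hζ.ne)
          (ENNReal.sum_lt_top.2 fun k hk => ?_)⟩)
      exact ENNReal.mul_lt_top (by simp) (ENNReal.rpow_lt_top_of_nonneg (by positivity)
        (ih k (Finset.mem_range.1 hk)).ne)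
  set μ := absMoment P p (ζ 0)
  set a : ℕ → ℝ≥0∞ := fun k => absMoment P p (kernelCoeff P ζ Q α β X (t - k) t) ^ (2 / p) with ha
  set D : ℝ≥0∞ := (ENNReal.ofReal c * (C : ℝ≥0∞) ^ (1 / p) * μ ^ (1 / p)) ^ 2 with hD
  have hDeq : D = ENNReal.ofReal c ^ 2 * (C : ℝ≥0∞) ^ (2 / p) * μ ^ (2 / p) := by
    rw [hD, mul_pow, mul_pow, ← ENNReal.rpow_mul_natCast, ← ENNReal.rpow_mul_natCast,
      show 1 / p * (2 : ℕ) = 2 / p by push_cast; ring]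
  set W := ∑' i : ℕ, ENNReal.ofReal (α i ^ 2) * ∑' k : ℕ, D ^ (k + 1) * nestedSum β k i with hW
  have hKW : KQp p C μ c α β = (C : ℝ≥0∞) ^ (2 / p) * W := by
    rw [KQp, hW]
    congr 1
    refine tsum_congr fun i => ?_
    congr 1
    refine tsum_congr fun k => ?_
    rw [hD, ← pow_mul]
    ring_nf
  have hsum : μ ^ (2 / p) * ∑' k, a k ≤ W := by
    rw [← ENNReal.tsum_mul_left]
    refine tsum_le_of_recursion fun i => ?_
    rw [hDeq]
    refine (mul_le_mul_right (hX.absMoment_kernelCoeff_le hC hp h hζ hQ hc hQc t i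
      fun k _ => hfin k) (μ ^ (2 / p))).trans_eq ?_
    rw [Finset.mul_sum]
    simp only [ha, mul_left_comm (ENNReal.ofReal (β _ _ ^ 2)) (μ ^ (2 / p))]
    ring
  have hWfin : W < ∞ := by
    rw [hKW] at hK
    refine ENNReal.lt_top_of_mul_ne_top_right hK.ne ?_
    have : (C : ℝ≥0∞) ≠ 0 := ENNReal.coe_ne_zero.2 (hC.ne_zero hp0 h)
    simp [this, hp0, ENNReal.rpow_eq_zero_iff]
  have hafin : ∑' k, a k < ∞ := by
    refine ENNReal.lt_top_of_mul_ne_top_right (hsum.trans_lt hWfin).ne ?_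
    simp [h.absMoment_ne_zero hp0, μ, ENNReal.rpow_eq_zero_iff, hζ.ne]
  have hros := hC Ω P ζ h _ _ (hX.isProjectiveWith_sub_const h hQ) hζ t hafin
  rw [hX.integral_sub_const_eq_zero h hQ, enorm_zero, ENNReal.zero_rpow_of_pos hp0,
    zero_add] at hros
  calc absMoment P p (fun ω => X t ω - m) ^ (2 / p)
      ≤ (C * (μ * (∑' k, a k) ^ (p / 2))) ^ (2 / p) := ENNReal.rpow_le_rpow hros (by positivity)
    _ = C ^ (2 / p) * (μ ^ (2 / p) * ∑' k, a k) := by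
      rw [ENNReal.mul_rpow_of_nonneg _ _ (by positivity),
        ENNReal.mul_rpow_of_nonneg _ _ (by positivity), ← ENNReal.rpow_mul,
        show p / 2 * (2 / p) = 1 by field_simp, ENNReal.rpow_one]
    _ ≤ KQp p C μ c α β := by rw [hKW]; gcongr

lemma IsSolution.ae_eq_const_of_forall_eq_zero (h : IsInnovation P ζ) (hQ : Measurable Q)
    (hQ0 : Q 0 = 0) (hα : ∀ i, α i = 0) (hX : IsSolution P ζ m Q α β X) (t : ℤ) :
    (fun ω => X t ω - m) =ᵐ[P] fun _ => 0 := by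
  have h0 : ∀ i : ℕ, kernelCoeff P ζ Q α β X (t - i) t =ᵐ[P] fun _ => 0 := by
    intro i
    induction i using Nat.strong_induction_on with
    | _ i ih =>
      filter_upwards [hX.kernelCoeff_recursion h hQ t i,
        (Finset.range i).eventually_all.2 fun k hk => ih k (Finset.mem_range.1 hk)] with ω h1 h2
      rw [h1, hα, partialSum, Finset.sum_eq_zero, add_zero, hQ0]
      intro k hk
      rw [h2 k hk, mul_zero, zero_mul]
  have h1 : ∀ n : ℕ, eLpNorm (fun ω => X t ω - m - ∑ k ∈ Finset.range n,
      kernelCoeff P ζ Q α β X (t - k) t ω * ζ (t - k) ω) 2 P =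
      eLpNorm (fun ω => X t ω - m) 2 P := by
    intro n
    refine eLpNorm_congr_ae ?_
    filter_upwards [ae_all_iff.2 h0] with ω hω
    rw [Finset.sum_eq_zero fun k _ => by rw [hω k, zero_mul], sub_zero]
  have h2 := hX.equation t
  rw [IsMeanSquareSum] at h2
  simp only [h1] at h2
  exact (eLpNorm_eq_zero_iff ((hX.memLp t).sub (memLp_const m)).1 two_ne_zero).1
    (tendsto_nhds_unique tendsto_const_nhds h2)

/-- If the innovations have infinite moment, then `K_{Q,p}` is finite only for `α = 0`. -/
lemma eq_zero_of_KQp_top_lt_top {p : ℝ} (hp : 0 < p) {C : ℝ≥0} (hC : C ≠ 0) {c : ℝ} (hc : 0 < c)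
    (hK : KQp p C ∞ c α β < ∞) (i : ℕ) : α i = 0 := by
  by_contra hi
  have hC' : (C : ℝ≥0∞) ≠ 0 := ENNReal.coe_ne_zero.2 hC
  have hCr : ∀ r : ℝ, (C : ℝ≥0∞) ^ r ≠ 0 := fun r => by simp [ENNReal.rpow_eq_zero_iff, hC']
  have h1 : ENNReal.ofReal c * (C : ℝ≥0∞) ^ (1 / p) * ∞ ^ (1 / p) = ∞ := by
    rw [ENNReal.top_rpow_of_pos (by positivity), ENNReal.mul_top]
    exact mul_ne_zero (by simpa using hc) (hCr _)
  have h2 : (∑' k : ℕ, (ENNReal.ofReal c * (C : ℝ≥0∞) ^ (1 / p) * ∞ ^ (1 / p)) ^ (2 * k + 2) *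
      nestedSum β k i) = ∞ := by
    refine ENNReal.tsum_eq_top_of_eq_top ⟨0, ?_⟩
    rw [h1]
    simp [nestedSum]
  refine hK.ne ?_
  rw [KQp, ENNReal.tsum_eq_top_of_eq_top ⟨i, ?_⟩, ENNReal.mul_top (hCr _)]
  rw [h2, ENNReal.mul_top]
  simpa [sq_nonneg] using hi

end MomentBound

end ProjectiveEq

theorem mainTheorem5 (p : ℝ) (hp : 2 ≤ p) :
    (∃ C : ℝ≥0, ProjectiveEq.IsRosenthalConstant.{u} p C) ∧
    ∀ C : ℝ≥0, ProjectiveEq.IsRosenthalConstant.{u} p C →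
      ∀ (Ω : Type u) [MeasurableSpace Ω] (P : Measure Ω) [IsProbabilityMeasure P]
        (ζ : ℤ → Ω → ℝ), ProjectiveEq.IsInnovation P ζ →
      ∀ (m : ℝ) (α : ℕ → ℝ) (β : ℕ → ℕ → ℝ) (Q : ℝ → ℝ) (c : ℝ),
        Measurable Q → 0 < c → (∀ x, |Q x| ≤ c * |x|) →
        ProjectiveEq.KQ c α β < ∞ →
        ProjectiveEq.KQp p C (ProjectiveEq.absMoment P p (ζ 0)) c α β < ∞ →
      ∀ X : ℤ → Ω → ℝ, ProjectiveEq.IsSolution P ζ m Q α β X →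
      ∀ t : ℤ,
        ProjectiveEq.absMoment P p (X t) < ∞ ∧
        ProjectiveEq.absMoment P p (fun ω => X t ω - m) ^ (2 / p) ≤
          ProjectiveEq.KQp p C (ProjectiveEq.absMoment P p (ζ 0)) c α β := by
  have hp0 : 0 < p := by linarith
  refine ⟨ProjectiveEq.exists_isRosenthalConstant hp, ?_⟩
  intro C hC Ω _ P _ ζ h m α β Q c hQ hc hQc _ hK X hX t
  have hbound : ProjectiveEq.absMoment P p (fun ω => X t ω - m) ^ (2 / p) ≤
      ProjectiveEq.KQp p C (ProjectiveEq.absMoment P p (ζ 0)) c α β := by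
    rcases eq_or_ne (ProjectiveEq.absMoment P p (ζ 0)) ∞ with hζ | hζ
    · have hQ0 : Q 0 = 0 := by simpa using hQc 0
      have hα := ProjectiveEq.eq_zero_of_KQp_top_lt_top hp0 (hC.ne_zero hp0 h) hc (hζ ▸ hK)
      rw [ProjectiveEq.absMoment_congr (hX.ae_eq_const_of_forall_eq_zero h hQ hQ0 hα t),
        ProjectiveEq.absMoment_zero hp0, ENNReal.zero_rpow_of_pos (by positivity)]
      exact zero_le
    · exact hX.absMoment_sub_const_le hC hp h hζ.lt_top hQ hc hQc hK t
  refine ⟨?_, hbound⟩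
  have hfin : ProjectiveEq.absMoment P p (fun ω => X t ω - m) < ∞ :=
    (ENNReal.rpow_lt_top_iff_of_pos (y := 2 / p) (by positivity)).1 (hbound.trans_lt hK)
  have hadd := ProjectiveEq.absMoment_add_le (P := P) (p := p) (by linarith)
    (f := fun ω => X t ω - m) (g := fun _ => m) ((hX.memLp t).sub (memLp_const m)).1
  simp only [sub_add_cancel, ProjectiveEq.absMoment_const] at hadd
  exact hadd.trans_lt (ENNReal.mul_lt_top
    (ENNReal.rpow_lt_top_of_nonneg (by linarith) (by norm_num))
    (ENNReal.add_lt_top.2 ⟨hfin, ENNReal.rpow_lt_top_of_nonneg hp0.le enorm_ne_top⟩))
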